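/- Let $k$ be a field of characteristic $0$. Consider the free shuffle operad over $k$ on two binary generators $x$ and $z$, where $x(1\;2)$ stands for a commutative product ($x(2\;1)=x(1\;2)$) and $z(1\;2)$ for a Lie bracket ($z(2\;1)=-z(1\;2)$); its component of arity $n$ has as a basis the shuffle tree monomials, i.e. binary trees with vertices labelled by $x,z$ and leaves labelled bijectively by $1,\dots,n$ such that at each vertex the minimal label on the left is smaller than the minimal label on the right. A set of multilinear identities in $x_1x_2=x(1\;2)$ and $[x_1,x_2]=z(1\;2)$ gives a shuffle operad: write the identities for all permutations of the variables, rewrite them in shuffle tree monomials using the (anti)commutativity of the generators, and divide the free shuffle operad by the ideal that they generate. Let $\mathrm{Com}\text{-}\mathrm{GD}_{\mathrm{Sh}}(x,z)$ be the shuffle operad obtained in this way from the identities of commutative Gelfand–Dorfman algebras: $(V,\cdot)$ is a commutative Novikov algebra, $$(x_1x_2)x_3-x_1(x_2x_3)=(x_2x_1)x_3-x_2(x_1x_3),\qquad (x_1x_2)x_3=(x_1x_3)x_2,$$ $(V,[\cdot,\cdot])$ is a Lie algebra, and $$[x_1,x_2x_3]-[x_3,x_2x_1]+[x_2,x_1]x_3-[x_2,x_3]x_1-x_2[x_1,x_3]=0.$$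 Let $\mathrm{TP}_{\mathrm{Sh}}(x,z)$ be the one obtained from the identities of transposed Poisson algebras: $\cdot$ is commutative and associative, $[\cdot,\cdot]$ is a Lie bracket, and $2[x_1,x_2]x_3=[x_1x_3,x_2]+[x_1,x_2x_3]$. Order the tree monomials of arity $n$ by the path-permutation-lexicographic order with $x<z$: compare lexicographically the sequences of the $n$ words of generators read along the paths from the root to the leaves $1,\dots,n$, two words being compared first by length and then lexicographically; if the sequences are equal, compare lexicographically the sequences of leaf labels read from left to right. **Theorem.** The part of arity at most $4$ of the reduced Gröbner basis of the ideal of relations of $\mathrm{Com}\text{-}\mathrm{GD}_{\mathrm{Sh}}(x,z)$ consists exactly of the following relations, in each of which the left-hand side is the leading monomial: $$\begin{aligned} x(x(1\;3)\;2)&\to x(1\;x(2\;3)),\\ x(x(1\;2)\;3)&\to x(1\;x(2\;3)),\\ z(x(1\;2)\;3)&\to 2\,x(z(1\;3)\;2)-z(1\;x(2\;3)),\\ x(z(1\;2)\;3)&\to x(z(1\;3)\;2)-x(1\;z(2\;3)),\\ z(z(1\;2)\;3)&\to z(z(1\;3)\;2)+z(1\;z(2\;3)),\\ z(x(1\;3)\;2)&\to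 2\,x(z(1\;3)\;2)-z(1\;x(2\;3))-2\,x(1\;z(2\;3)),\\ x(z(1\;4)\;z(2\;3))&\to x(z(1\;3)\;z(2\;4))-x(z(1\;z(3\;4))\;2)+x(1\;z(2\;z(3\;4))),\\ x(z(1\;3)\;x(2\;4))&\to z(1\;x(2\;x(3\;4)))+3\,x(1\;x(z(2\;4)\;3))-2\,x(1\;z(2\;x(3\;4)))-2\,x(1\;x(2\;z(3\;4))),\\ x(z(1\;4)\;x(2\;3))&\to z(1\;x(2\;x(3\;4)))+3\,x(1\;x(z(2\;4)\;3))-2\,x(1\;z(2\;x(3\;4)))-x(1\;x(2\;z(3\;4))),\\ x(z(1\;x(3\;4))\;2)&\to z(1\;x(2\;x(3\;4)))+2\,x(1\;x(z(2\;4)\;3))-x(1\;z(2\;x(3\;4)))-x(1\;x(2\;z(3\;4))),\\ z(z(1\;4)\;x(2\;3))&\to z(z(1\;x(3\;4))\;2)-2\,x(z(1\;3)\;z(2\;4))+z(1\;x(z(2\;4)\;3))+z(1\;z(2\;x(3\;4)))+2\,x(1\;z(z(2\;4)\;3)),\\ z(z(1\;3)\;x(2\;4))&\to z(z(1\;x(3\;4))\;2)-2\,x(z(1\;3)\;z(2\;4))+2\,x(z(1\;z(3\;4))\;2)+z(1\;x(z(2\;4)\;3))\\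 &\qquad+z(1\;z(2\;x(3\;4)))-z(1\;x(2\;z(3\;4)))+2\,x(1\;z(z(2\;4)\;3)). \end{aligned}$$ That is: every relation $u-v$ given by a rule $u\to v$ of the list lies in the ideal and has leading monomial $u$; the leading monomial of every non-zero element of the ideal of arity at most $4$ is divisible by a left-hand side of the list; no left-hand side is divisible by another one; and no monomial of a right-hand side is divisible by a left-hand side. The same list is the part of arity at most $4$ of the reduced Gröbner basis of the ideal of relations of $\mathrm{TP}_{\mathrm{Sh}}(x,z)$; moreover, the two ideals of relations coincide in every arity, so that $\mathrm{Com}\text{-}\mathrm{GD}=\mathrm{TP}$. -/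

import Mathlib

/-! Tree monomials, the free shuffle operad on two binary generators `x` (commutative product) and
`z` (Lie bracket), its ideals, Gröbner bases, and the shuffle operads of commutative
Gelfand-Dorfman algebras and of transposed Poisson algebras. -/

namespace ShuffleGD

/-- The two binary generators: `x` for the commutative product, `z` for the Lie bracket. -/
inductive Op where
  | x : Op
  | z : Op
  deriving DecidableEq

/-- The rank of a generator in the ordering `x < z` of the alphabet. -/
def Op.rank : Op → ℕ
  | .x => 0
  | .z => 1

/-- The effect of exchanging the two arguments: `x` is commutative, `z` is anticommutative. -/
def Op.swapSign : Op → ℤ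
  | .x => 1
  | .z => -1

/-- Binary trees with vertices labelled by generators and leaves labelled by `α`. -/
inductive OpTree (α : Type) where
  | leaf : α → OpTree α
  | node : Op → OpTree α → OpTree α → OpTree α
  deriving DecidableEq

namespace OpTree

variable {α β : Type}

/-- The leaf labels, read from left to right. -/
def leaves : OpTree α → List α
  | leaf a => [a]
  | node _ l r => l.leaves ++ r.leaves

/-- Simultaneous grafting of trees at the leaves. -/
def bind : OpTree α → (α → OpTree β) → OpTree β
  | leaf a, σ => σ a
  | node o l r, σ => node o (l.bind σ) (r.bind σ)

/-- Relabelling of the leaves. -/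
def map (f : α → β) (T : OpTree α) : OpTree β := T.bind fun a => leaf (f a)

/-- The smallest leaf label. -/
def minLeaf [LinearOrder α] : OpTree α → α
  | leaf a => a
  | node _ l r => min l.minLeaf r.minLeaf

/-- At every vertex the smallest label on the left is smaller than the smallest one on the right. -/
def IsOrdered [LinearOrder α] : OpTree α → Prop
  | leaf _ => True
  | node _ l r => l.minLeaf < r.minLeaf ∧ l.IsOrdered ∧ r.IsOrdered

/-- `S` is the full subtree of `T` above some vertex or leaf of `T`. -/
def IsSubtree (S : OpTree α) : OpTree α → Prop
  | leaf a => S = leaf a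
  | node o l r => S = node o l r ∨ S.IsSubtree l ∨ S.IsSubtree r

/-- The word of generators met on the way from the root to the leaf labelled `a`. -/
def path [DecidableEq α] : OpTree α → α → List Op
  | leaf _, _ => []
  | node o l r, a => o :: (if a ∈ l.leaves then l.path a else r.path a)

/-- The shuffle tree obtained from an arbitrary tree by exchanging, where necessary, the two
arguments of a vertex. -/
def toShuffle [LinearOrder α] : OpTree α → OpTree α
  | leaf a => leaf a
  | node o l r =>
      if l.minLeaf < r.minLeaf then node o l.toShuffle r.toShuffle
      else node o r.toShuffle l.toShuffle

/-- The sign produced by these exchanges. -/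
def shuffleSign [LinearOrder α] : OpTree α → ℤ
  | leaf _ => 1
  | node o l r =>
      (if l.minLeaf < r.minLeaf then 1 else o.swapSign) * (l.shuffleSign * r.shuffleSign)

end OpTree

/-- Shuffle tree monomials of arity `n`: every label in `{1, ..., n}` (here `Fin n`) occurs exactly
once, and at every vertex the left minimum is smaller than the right minimum. -/
def IsShuffleTree {n : ℕ} (T : OpTree (Fin n)) : Prop :=
  T.leaves.Nodup ∧ (∀ i, i ∈ T.leaves) ∧ T.IsOrdered

/-- Linear combinations of trees of arity `n`. -/
abbrev Poly (k : Type*) [Field k] (n : ℕ) := OpTree (Fin n) →₀ k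

/-- The arity `n` component of the free shuffle operad on `x` and `z`: linear combinations of
shuffle tree monomials. -/
def freeShuffle (k : Type*) [Field k] (n : ℕ) : Submodule k (Poly k n) :=
  Finsupp.supported k k {T | IsShuffleTree T}

/-- The data of a partial shuffle composition, in which an operation of arity `m` is inserted into
the `i`-th input of an operation of arity `n`, giving an operation of arity `N = n + m - 1`. The
inputs of both operations are renumbered increasingly by `outer` and `inner`; the block of inputs
`range inner` takes the place of the `i`-th input, whose new number is the minimum of the block. -/
structure ShuffleInsertion (n m N : ℕ) where
  i : Fin n
  outer : Fin n ↪o Fin N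
  inner : Fin m ↪o Fin N
  isLeast : IsLeast (Set.range inner) (outer i)
  inter : Set.range outer ∩ Set.range inner = {outer i}
  union : Set.range outer ∪ Set.range inner = Set.univ

/-- Partial shuffle composition of tree monomials. -/
def ShuffleInsertion.compTree {n m N : ℕ} (w : ShuffleInsertion n m N)
    (T : OpTree (Fin n)) (S : OpTree (Fin m)) : OpTree (Fin N) :=
  T.bind fun j => if j = w.i then S.map w.inner else .leaf (w.outer j)

/-- Partial shuffle composition, extended bilinearly. -/
noncomputable def ShuffleInsertion.comp {k : Type*} [Field k] {n m N : ℕ}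
    (w : ShuffleInsertion n m N) (f : Poly k n) (g : Poly k m) : Poly k N :=
  f.sum fun T a => g.sum fun S b => Finsupp.single (w.compTree T S) (a * b)

/-- Ideals of the free shuffle operad. -/
structure IsShuffleIdeal {k : Type*} [Field k] (I : ∀ n, Submodule k (Poly k n)) : Prop where
  le_free : ∀ n, I n ≤ freeShuffle k n
  comp_left : ∀ {n m N : ℕ} (w : ShuffleInsertion n m N) (f : Poly k n) (g : Poly k m),
    f ∈ I n → g ∈ freeShuffle k m → w.comp f g ∈ I N
  comp_right : ∀ {n m N : ℕ} (w : ShuffleInsertion n m N) (f : Poly k n) (g : Poly k m),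
    f ∈ freeShuffle k n → g ∈ I m → w.comp f g ∈ I N

/-- The ideal generated by a set of elements of arity 3: the intersection of all ideals that
contain the set. -/
noncomputable def generatedIdeal {k : Type*} [Field k] (R : Set (Poly k 3)) (n : ℕ) : Submodule k (Poly k n) :=
  sInf {V | ∃ I : ∀ n, Submodule k (Poly k n), IsShuffleIdeal I ∧ R ⊆ I 3 ∧ I n = V}

/-- Shuffle form of a multilinear polynomial in a commutative product `x` and an anticommutative
product `z`. -/
noncomputable def shuffleForm {k : Type*} [Field k] {n : ℕ} (f : Poly k n) : Poly k n :=
  f.sum fun T a => Finsupp.single T.toShuffle ((T.shuffleSign : k) * a)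

/-- The relations of a shuffle operad that correspond to a set of multilinear identities of
degree 3 in a commutative product `x` and an anticommutative product `z`: all identities are
written for all permutations of the variables and put into shuffle form. -/
def shuffleRelations {k : Type*} [Field k] (E : Set (Poly k 3)) : Set (Poly k 3) :=
  {g | ∃ f ∈ E, ∃ σ : Equiv.Perm (Fin 3), g = shuffleForm (f.mapDomain (OpTree.map σ))}

/-- The variable, or input, number 1. -/
abbrev v₁ {n : ℕ} [NeZero n] : OpTree (Fin n) := .leaf 0
/-- The variable, or input, number 2. -/
abbrev v₂ {n : ℕ} [NeZero n] : OpTree (Fin n) := .leaf 1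
/-- The variable, or input, number 3. -/
abbrev v₃ {n : ℕ} [NeZero n] : OpTree (Fin n) := .leaf 2
/-- The variable, or input, number 4. -/
abbrev v₄ {n : ℕ} [NeZero n] : OpTree (Fin n) := .leaf 3

/-- The tree `x(l r)`, that is, the product of `l` and `r`. -/
abbrev X {α : Type} (l r : OpTree α) : OpTree α := .node .x l r

/-- The tree `z(l r)`, that is, the bracket of `l` and `r`. -/
abbrev Z {α : Type} (l r : OpTree α) : OpTree α := .node .z l r

/-- A tree as a monomial with coefficient 1. -/
noncomputable abbrev mon {k : Type*} [Field k] {n : ℕ} (T : OpTree (Fin n)) : Poly k n :=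
  Finsupp.single T 1

section Identities

variable (k : Type*) [Field k]

/-- `(x₁ x₂) x₃ = x₁ (x₂ x₃)` -/
noncomputable def assocId : Poly k 3 := mon (X (X v₁ v₂) v₃) - mon (X v₁ (X v₂ v₃))

/-- `(x₁ x₂) x₃ - x₁ (x₂ x₃) = (x₂ x₁) x₃ - x₂ (x₁ x₃)` -/
noncomputable def leftSymId : Poly k 3 :=
  (mon (X (X v₁ v₂) v₃) - mon (X v₁ (X v₂ v₃))) - (mon (X (X v₂ v₁) v₃) - mon (X v₂ (X v₁ v₃)))

/-- `(x₁ x₂) x₃ = (x₁ x₃) x₂` -/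
noncomputable def rightComId : Poly k 3 := mon (X (X v₁ v₂) v₃) - mon (X (X v₁ v₃) v₂)

/-- `[[x₁, x₂], x₃] + [[x₂, x₃], x₁] + [[x₃, x₁], x₂] = 0` -/
noncomputable def jacobiId : Poly k 3 :=
  mon (Z (Z v₁ v₂) v₃) + mon (Z (Z v₂ v₃) v₁) + mon (Z (Z v₃ v₁) v₂)

/-- `[x₁, x₂ x₃] - [x₃, x₂ x₁] + [x₂, x₁] x₃ - [x₂, x₃] x₁ - x₂ [x₁, x₃] = 0` -/
noncomputable def gdId : Poly k 3 :=
  mon (Z v₁ (X v₂ v₃)) - mon (Z v₃ (X v₂ v₁)) + mon (X (Z v₂ v₁) v₃) - mon (X (Z v₂ v₃) v₁)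
    - mon (X v₂ (Z v₁ v₃))

/-- `2 [x₁, x₂] x₃ = [x₁ x₃, x₂] + [x₁, x₂ x₃]` -/
noncomputable def tpId : Poly k 3 :=
  (2 : k) • mon (X (Z v₁ v₂) v₃) - (mon (Z (X v₁ v₃) v₂) + mon (Z v₁ (X v₂ v₃)))

/-- The ideal of relations of the shuffle operad of commutative Gelfand-Dorfman algebras: the
product is commutative and Novikov, the bracket is a Lie bracket, and the Gelfand-Dorfman identity
holds. -/
noncomputable def comGDIdeal (n : ℕ) : Submodule k (Poly k n) :=
  generatedIdeal (shuffleRelations {leftSymId k, rightComId k, jacobiId k, gdId k}) n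

/-- The ideal of relations of the shuffle operad of transposed Poisson algebras: the product is
commutative and associative, the bracket is a Lie bracket, and the transposed Leibniz identity
holds. -/
noncomputable def transposedPoissonIdeal (n : ℕ) : Submodule k (Poly k n) :=
  generatedIdeal (shuffleRelations {assocId k, jacobiId k, tpId k}) n

end Identities

/-- A word of generators, encoded so that the lexicographic order of the codes is the
degree-lexicographic order of words with `x < z`: the length comes first, then the letters. -/
def wordKey (u : List Op) : List ℕ := u.length :: u.map Op.rank

/-- The key of a tree monomial for the path-permutation-lexicographic order: the sequence of the
path words of the leaves `1, ..., n`, compared lexicographically; then the sequence of the leaf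
labels from left to right, compared lexicographically. -/
def orderKey {n : ℕ} (T : OpTree (Fin n)) : List (List ℕ) ×ₗ List (Fin n) :=
  toLex (List.ofFn fun i => wordKey (T.path i), T.leaves)

/-- `T` is the leading monomial of `f` in the path-permutation-lexicographic order. -/
def IsLeadingMonomial {k : Type*} [Field k] {n : ℕ} (f : Poly k n) (T : OpTree (Fin n)) : Prop :=
  T ∈ f.support ∧ ∀ S ∈ f.support, S ≠ T → orderKey S < orderKey T

/-- Divisibility of shuffle tree monomials: `S` occurs inside `T` at some vertex, with some trees
`σ i` hanging at the inputs `i` of this occurrence, and the order of the inputs of `S` is the order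
of the minimal leaves of the trees `σ i`. -/
def Divides {m n : ℕ} (S : OpTree (Fin m)) (T : OpTree (Fin n)) : Prop :=
  ∃ σ : Fin m → OpTree (Fin n), StrictMono (fun i => (σ i).minLeaf) ∧ (S.bind σ).IsSubtree T

/-- A rewriting rule `lhs → rhs` in the free shuffle operad. -/
structure Rule (k : Type*) [Field k] where
  arity : ℕ
  lhs : OpTree (Fin arity)
  rhs : Poly k arity

/-- The relation `lhs - rhs` that a rule `lhs → rhs` stands for. -/
noncomputable def Rule.relation {k : Type*} [Field k] (r : Rule k) : Poly k r.arity :=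
  mon r.lhs - r.rhs

/-- `G` is the part in arities `≤ d` of the reduced Gröbner basis of the ideal `I`, its elements
being written as rewriting rules `leading monomial → - (remaining terms)`: all relations lie in `I`,
each left-hand side is the leading monomial of its relation, the leading monomial of every non-zero
element of `I` of arity at most `d` is divisible by a left-hand side, no monomial of a right-hand
side is divisible by a left-hand side, and no left-hand side is divisible by another one. -/
structure IsReducedGroebnerBasisUpTo {k : Type*} [Field k]
    (I : ∀ n, Submodule k (Poly k n)) (d : ℕ) (G : Set (Rule k)) : Prop where
  arity_le : ∀ r ∈ G, r.arity ≤ d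
  relation_mem : ∀ r ∈ G, r.relation ∈ I r.arity
  leading : ∀ r ∈ G, IsLeadingMonomial r.relation r.lhs
  divides_leading : ∀ n ≤ d, ∀ f ∈ I n, f ≠ 0 →
    ∃ T, IsLeadingMonomial f T ∧ ∃ r ∈ G, Divides r.lhs T
  rhs_reduced : ∀ r ∈ G, ∀ T ∈ r.rhs.support, ∀ s ∈ G, ¬ Divides s.lhs T
  lhs_reduced : ∀ r ∈ G, ∀ s ∈ G, Divides s.lhs r.lhs → s = r

section Rules

variable (k : Type*) [Field k]

/-- The rewriting rules of arity 3. -/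
noncomputable def rulesThree : List (Rule k) := [
  ⟨3, X (X v₁ v₃) v₂, mon (X v₁ (X v₂ v₃))⟩,
  ⟨3, X (X v₁ v₂) v₃, mon (X v₁ (X v₂ v₃))⟩,
  ⟨3, Z (X v₁ v₂) v₃, (2 : k) • mon (X (Z v₁ v₃) v₂) - mon (Z v₁ (X v₂ v₃))⟩,
  ⟨3, X (Z v₁ v₂) v₃, mon (X (Z v₁ v₃) v₂) - mon (X v₁ (Z v₂ v₃))⟩,
  ⟨3, Z (Z v₁ v₂) v₃, mon (Z (Z v₁ v₃) v₂) + mon (Z v₁ (Z v₂ v₃))⟩,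
  ⟨3, Z (X v₁ v₃) v₂,
    (2 : k) • mon (X (Z v₁ v₃) v₂) - mon (Z v₁ (X v₂ v₃)) - (2 : k) • mon (X v₁ (Z v₂ v₃))⟩]

/-- The rewriting rules of arity 4. -/
noncomputable def rulesFour : List (Rule k) := [
  ⟨4, X (Z v₁ v₄) (Z v₂ v₃),
    mon (X (Z v₁ v₃) (Z v₂ v₄)) - mon (X (Z v₁ (Z v₃ v₄)) v₂) + mon (X v₁ (Z v₂ (Z v₃ v₄)))⟩,
  ⟨4, X (Z v₁ v₃) (X v₂ v₄),
    mon (Z v₁ (X v₂ (X v₃ v₄))) + (3 : k) • mon (X v₁ (X (Z v₂ v₄) v₃))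
      - (2 : k) • mon (X v₁ (Z v₂ (X v₃ v₄))) - (2 : k) • mon (X v₁ (X v₂ (Z v₃ v₄)))⟩,
  ⟨4, X (Z v₁ v₄) (X v₂ v₃),
    mon (Z v₁ (X v₂ (X v₃ v₄))) + (3 : k) • mon (X v₁ (X (Z v₂ v₄) v₃))
      - (2 : k) • mon (X v₁ (Z v₂ (X v₃ v₄))) - mon (X v₁ (X v₂ (Z v₃ v₄)))⟩,
  ⟨4, X (Z v₁ (X v₃ v₄)) v₂,
    mon (Z v₁ (X v₂ (X v₃ v₄))) + (2 : k) • mon (X v₁ (X (Z v₂ v₄) v₃))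
      - mon (X v₁ (Z v₂ (X v₃ v₄))) - mon (X v₁ (X v₂ (Z v₃ v₄)))⟩,
  ⟨4, Z (Z v₁ v₄) (X v₂ v₃),
    mon (Z (Z v₁ (X v₃ v₄)) v₂) - (2 : k) • mon (X (Z v₁ v₃) (Z v₂ v₄))
      + mon (Z v₁ (X (Z v₂ v₄) v₃)) + mon (Z v₁ (Z v₂ (X v₃ v₄)))
      + (2 : k) • mon (X v₁ (Z (Z v₂ v₄) v₃))⟩,
  ⟨4, Z (Z v₁ v₃) (X v₂ v₄),
    mon (Z (Z v₁ (X v₃ v₄)) v₂) - (2 : k) • mon (X (Z v₁ v₃) (Z v₂ v₄))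
      + (2 : k) • mon (X (Z v₁ (Z v₃ v₄)) v₂) + mon (Z v₁ (X (Z v₂ v₄) v₃))
      + mon (Z v₁ (Z v₂ (X v₃ v₄))) - mon (Z v₁ (X v₂ (Z v₃ v₄)))
      + (2 : k) • mon (X v₁ (Z (Z v₂ v₄) v₃))⟩]

/-- All listed rewriting rules. -/
def rules : Set (Rule k) := {r | r ∈ rulesThree k ∨ r ∈ rulesFour k}

end Rules

end ShuffleGD

/-! Equality of the ideals is linear algebra in arity 3. For a commutative product, left symmetry is
associativity. Summing the transposed Leibniz identity over cyclic permutations cancels all brackets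
containing products and leaves twice the cyclic identity `[x₁,x₂]x₃ + [x₂,x₃]x₁ + [x₃,x₁]x₂ = 0`.
The Gelfand-Dorfman identity also implies the cyclic identity, and modulo it becomes the transposed
Leibniz identity with renamed variables. In characteristic 0 both sets of relations therefore span
the same space, with the six relations of arity 3 in the list as a basis (`span_comGD`,
`span_transposedPoisson`). A generated ideal depends only on this span (`generatedIdeal_congr`).

The rules of arity 4 lie in the ideal by explicit certificates: a multiple of each is a combination
of compositions of rules of arity 3 with generators (`compositions₄_spec`).

Conversely, the ideal must be bounded from above in arity 4. Let `N` be the linear extension of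
`normalForm 5`. It kills every composition of a basic relation with a generator, it fixes
irreducible trees, and it sends a tree to trees that are not larger. Setting zero below arity 3, the
span of the basic relations in arity 3, the kernel of `N` in arity 4 and everything above gives an
ideal (`isShuffleIdeal_truncatedIdeal`), because a composition of arity at most 4 that involves a
relation is a composition with the unit or of a relation of arity 3 with a generator. Hence the
generated ideal lies in it. If an element of the kernel had an irreducible leading monomial, `N`
would preserve its coefficient, which is absurd (`isReducible_of_isLeadingMonomial`).

All computations use lists with integer coefficients, are decided by evaluation, and are carried
over to the field by `ev`. -/

namespace ShuffleGD

/-! ### Formal sums with integer coefficients -/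

section IntSums

/-- The coefficient of `a` in a formal sum. -/
def coef {α : Type} [DecidableEq α] (L : List (ℤ × α)) (a : α) : ℤ :=
  (L.map fun p => if p.2 = a then p.1 else 0).sum

/-- Multiplication of a formal sum by an integer. -/
def scale {α : Type} (c : ℤ) (L : List (ℤ × α)) : List (ℤ × α) := L.map fun p => (c * p.1, p.2)

/-- Linear extension of a map from basis elements to formal sums. -/
def extend {α β : Type} (f : β → List (ℤ × α)) (L : List (ℤ × β)) : List (ℤ × α) :=
  L.flatMap fun p => scale p.1 (f p.2)

/-- All coefficients of a formal sum vanish. -/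
def isZero {α : Type} [DecidableEq α] (L : List (ℤ × α)) : Bool :=
  L.all fun p => coef L p.2 == 0

/-- The formal sum as a finitely supported function with values in `k`. -/
noncomputable def ev {α : Type} (k : Type*) [Field k] (L : List (ℤ × α)) : α →₀ k :=
  (L.map fun p => Finsupp.single p.2 (p.1 : k)).sum

variable {α β : Type} (k : Type*) [Field k]

@[simp] lemma ev_nil : ev k ([] : List (ℤ × α)) = 0 := rfl

@[simp] lemma ev_cons (p : ℤ × α) (L : List (ℤ × α)) :
    ev k (p :: L) = Finsupp.single p.2 (p.1 : k) + ev k L := by simp [ev]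

@[simp] lemma ev_append (L M : List (ℤ × α)) : ev k (L ++ M) = ev k L + ev k M := by
  simp [ev]

@[simp] lemma ev_scale (c : ℤ) (L : List (ℤ × α)) : ev k (scale c L) = (c : k) • ev k L := by
  induction L with
  | nil => simp [scale]
  | cons p L ih => simp only [scale, List.map_cons, ev_cons] at ih ⊢; rw [ih]; simp

lemma ev_apply [DecidableEq α] (L : List (ℤ × α)) (a : α) : ev k L a = (coef L a : k) := by
  induction L with
  | nil => simp [coef]
  | cons p L ih =>
    simp only [coef, List.map_cons, List.sum_cons, ev_cons, Finsupp.add_apply] at ih ⊢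
    rw [ih, Finsupp.single_apply]
    split_ifs <;> simp

lemma exists_mem_of_ev_ne_zero {L : List (ℤ × α)} {a : α} (h : ev k L a ≠ 0) :
    ∃ p ∈ L, p.2 = a := by
  classical
  induction L with
  | nil => simp at h
  | cons p L ih =>
    by_cases hp : p.2 = a
    · exact ⟨p, by simp, hp⟩
    · obtain ⟨q, hq, e⟩ := ih (by simpa [Finsupp.single_apply, hp] using h)
      exact ⟨q, by simp [hq], e⟩

/-- Only monomials that occur in the list can have a non-zero coefficient, so finitely many integer
tests suffice, over any field. -/
lemma ev_eq_zero [DecidableEq α] {L : List (ℤ × α)} (h : isZero L = true) : ev k L = 0 := by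
  ext a
  by_contra ha
  obtain ⟨p, hp, rfl⟩ := exists_mem_of_ev_ne_zero k ha
  simp only [isZero, List.all_eq_true, beq_iff_eq] at h
  exact ha (by simp [ev_apply, h p hp])

/-- Linear extension of a map from basis elements to formal sums. -/
noncomputable def evLinear (f : β → List (ℤ × α)) : (β →₀ k) →ₗ[k] (α →₀ k) :=
  Finsupp.linearCombination k fun b => ev k (f b)

lemma evLinear_single (f : β → List (ℤ × α)) (b : β) (c : k) :
    evLinear k f (Finsupp.single b c) = c • ev k (f b) := by
  simp [evLinear]

lemma evLinear_ev (f : β → List (ℤ × α)) (L : List (ℤ × β)) :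
    evLinear k f (ev k L) = ev k (extend f L) := by
  induction L with
  | nil => simp [extend]
  | cons p L ih =>
    simp only [extend, List.flatMap_cons, ev_cons, map_add, ev_append] at ih ⊢
    rw [ih, evLinear_single, ev_scale]

lemma ev_mem {V : Submodule k (α →₀ k)} {L : List (ℤ × α)}
    (h : ∀ p ∈ L, Finsupp.single p.2 (1 : k) ∈ V) : ev k L ∈ V := by
  induction L with
  | nil => simp
  | cons p L ih =>
    rw [ev_cons]
    refine V.add_mem ?_ (ih fun q hq => h q (by simp [hq]))
    have := V.smul_mem (p.1 : k) (h p (by simp))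
    simpa using this

end IntSums

/-! ### Trees -/

namespace OpTree

variable {α β : Type}

lemma leaves_ne_nil (T : OpTree α) : T.leaves ≠ [] := by
  induction T with
  | leaf a => simp [leaves]
  | node o l r hl hr => simp [leaves, hl]

lemma leaves_bind (T : OpTree α) (σ : α → OpTree β) :
    (T.bind σ).leaves = T.leaves.flatMap fun a => (σ a).leaves := by
  induction T with
  | leaf a => simp [leaves, bind]
  | node o l r hl hr => simp [leaves, bind, hl, hr]

lemma bind_leaf (T : OpTree α) : T.bind leaf = T := by
  induction T with
  | leaf a => rfl
  | node o l r hl hr => simp [bind, hl, hr]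

lemma map_id' (T : OpTree α) : T.map id = T := bind_leaf T

lemma leaves_map (f : α → β) (T : OpTree α) : (T.map f).leaves = T.leaves.map f := by
  rw [map, leaves_bind]
  simp only [leaves, ← List.map_eq_flatMap]

/-! ### Leaf minima and orderedness under grafting -/

section Order

variable [LinearOrder α] [LinearOrder β]

lemma minLeaf_le {T : OpTree α} {a : α} (h : a ∈ T.leaves) : T.minLeaf ≤ a := by
  induction T with
  | leaf b => simp_all [leaves, minLeaf]
  | node o l r hl hr =>
    simp only [leaves, List.mem_append] at h
    rcases h with h | h
    · exact (min_le_left _ _).trans (hl h)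
    · exact (min_le_right _ _).trans (hr h)

lemma minLeaf_bind {σ : α → OpTree β} {f : α → β} (hf : StrictMono f)
    (hσ : ∀ a, (σ a).minLeaf = f a) (T : OpTree α) : (T.bind σ).minLeaf = f T.minLeaf := by
  induction T with
  | leaf a => exact hσ a
  | node o l r hl hr => simp [bind, minLeaf, hl, hr, hf.monotone.map_min]

lemma isOrdered_bind {σ : α → OpTree β} {f : α → β} (hf : StrictMono f)
    (hσ : ∀ a, (σ a).minLeaf = f a) (hσ' : ∀ a, (σ a).IsOrdered) {T : OpTree α}
    (hT : T.IsOrdered) : (T.bind σ).IsOrdered := by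
  induction T with
  | leaf a => exact hσ' a
  | node o l r hl hr =>
    obtain ⟨h, h₁, h₂⟩ := hT
    refine ⟨?_, hl h₁, hr h₂⟩
    rw [minLeaf_bind hf hσ, minLeaf_bind hf hσ]
    exact hf h

lemma minLeaf_map {f : α → β} (hf : StrictMono f) (T : OpTree α) :
    (T.map f).minLeaf = f T.minLeaf :=
  minLeaf_bind hf (fun _ => rfl) T

lemma isOrdered_map {f : α → β} (hf : StrictMono f) {T : OpTree α} (hT : T.IsOrdered) :
    (T.map f).IsOrdered :=
  isOrdered_bind hf (fun _ => rfl) (fun a => show (leaf (f a)).IsOrdered from trivial) hT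

instance decidableIsOrdered : DecidablePred (IsOrdered (α := α))
  | leaf _ => inferInstanceAs (Decidable True)
  | node _ l r =>
    have := decidableIsOrdered l
    have := decidableIsOrdered r
    inferInstanceAs (Decidable (l.minLeaf < r.minLeaf ∧ l.IsOrdered ∧ r.IsOrdered))

end Order

end OpTree

open OpTree

instance decidableIsShuffleTree {n : ℕ} : DecidablePred (IsShuffleTree (n := n)) := fun T =>
  inferInstanceAs (Decidable (T.leaves.Nodup ∧ (∀ i, i ∈ T.leaves) ∧ T.IsOrdered))

/-! ### Enumeration of shuffle trees -/

/-- All ways to distribute the entries of a list over two lists. -/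
def splits {α : Type} : List α → List (List α × List α)
  | [] => [([], [])]
  | a :: l => (splits l).flatMap fun p => [(a :: p.1, p.2), (p.1, a :: p.2)]

lemma filter_mem_splits {α : Type} (q : α → Bool) (l : List α) :
    (l.filter q, l.filter fun a => !q a) ∈ splits l := by
  induction l with
  | nil => simp [splits]
  | cons a l ih =>
    simp only [splits, List.mem_flatMap]
    refine ⟨_, ih, ?_⟩
    cases h : q a <;> simp [h]

/-- All ordered trees with a given list of leaf labels; the first argument bounds the number of
leaves. -/
def orderedTrees {α : Type} [LinearOrder α] : ℕ → List α → List (OpTree α)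
  | 0, _ => []
  | b + 1, l =>
    (if l.length = 1 then l.map leaf else []) ++ (splits l).flatMap fun p =>
      (orderedTrees b p.1).flatMap fun L => (orderedTrees b p.2).flatMap fun R =>
        if L.minLeaf < R.minLeaf then [X L R, Z L R] else []

/-- The leaves of the left subtree cut the label list into two filtered sublists, which form one of
its `splits`. Both subtrees have leaves, so both sublists are shorter and the bound can drop by one.
-/
lemma mem_orderedTrees {α : Type} [LinearOrder α] {b : ℕ} {l : List α} {T : OpTree α}
    (hl : l.Nodup) (hT : T.leaves.Perm l) (ho : T.IsOrdered) (hb : l.length ≤ b) :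
    T ∈ orderedTrees b l := by
  induction T generalizing b l with
  | leaf a =>
    have h := List.perm_singleton.1 hT.symm
    subst h
    obtain _ | b := b
    · simp at hb
    · simp [orderedTrees]
  | node o L R hL hR =>
    have hnd := (hT.nodup_iff).2 hl
    simp only [leaves, List.nodup_append] at hnd
    obtain ⟨ho₀, ho₁, ho₂⟩ := ho
    have hlen := hT.length_eq
    have hLp := List.length_pos_iff.2 L.leaves_ne_nil
    have hRp := List.length_pos_iff.2 R.leaves_ne_nil
    simp only [leaves, List.length_append] at hlen
    have hmem : ∀ a, a ∈ l ↔ a ∈ L.leaves ∨ a ∈ R.leaves := fun a => by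
      rw [← hT.mem_iff]; simp [leaves]
    have pL : L.leaves.Perm (l.filter fun a => decide (a ∈ L.leaves)) := by
      refine (List.perm_ext_iff_of_nodup hnd.1 (hl.filter _)).2 fun a => ?_
      simp only [List.mem_filter, hmem, decide_eq_true_eq]
      tauto
    have pR : R.leaves.Perm (l.filter fun a => !decide (a ∈ L.leaves)) := by
      refine (List.perm_ext_iff_of_nodup hnd.2.1 (hl.filter _)).2 fun a => ?_
      simp only [List.mem_filter, hmem, Bool.not_eq_true', decide_eq_false_iff_not]
      have := hnd.2.2
      constructor
      · exact fun h => ⟨.inr h, fun h' => this a h' a h rfl⟩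
      · tauto
    obtain _ | b := b
    · omega
    have kL := hL (b := b) (hl.filter _) pL ho₁ (by have := pL.length_eq; omega)
    have kR := hR (b := b) (hl.filter _) pR ho₂ (by have := pR.length_eq; omega)
    simp only [orderedTrees, List.mem_append, List.mem_flatMap]
    refine .inr ⟨_, filter_mem_splits (fun a => decide (a ∈ L.leaves)) l, L, kL, R, kR, ?_⟩
    cases o <;> simp [ho₀]

/-- All shuffle tree monomials of arity `n`. -/
def shuffleTrees (n : ℕ) : List (OpTree (Fin n)) := orderedTrees n (List.finRange n)

lemma mem_shuffleTrees {n : ℕ} {T : OpTree (Fin n)} (h : IsShuffleTree T) :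
    T ∈ shuffleTrees n := by
  refine mem_orderedTrees (List.nodup_finRange n) ?_ h.2.2 (by simp)
  exact (List.perm_ext_iff_of_nodup h.1 (List.nodup_finRange n)).2 fun a => by simp [h.2.1 a]

/-! ### Insertions -/

/-- The tree part of a partial composition, for arbitrary renumberings of the inputs. -/
def insTree {n m N : ℕ} (i : Fin n) (o : Fin n → Fin N) (b : Fin m → Fin N)
    (T : OpTree (Fin n)) (S : OpTree (Fin m)) : OpTree (Fin N) :=
  T.bind fun j => if j = i then S.map b else .leaf (o j)

/-- Renumberings that come from a shuffle insertion. -/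
def IsInsertion {n m N : ℕ} (i : Fin n) (o : Fin n → Fin N) (b : Fin m → Fin N) : Prop :=
  ((∀ p q, p < q → o p < o q) ∧ ∀ p q, p < q → b p < b q) ∧
  ((∃ j, b j = o i) ∧ ∀ j, o i ≤ b j) ∧
  (∀ p q, o p = b q → p = i) ∧
  ∀ a, (∃ p, o p = a) ∨ ∃ q, b q = a

instance {n m N : ℕ} (i : Fin n) (o : Fin n → Fin N) (b : Fin m → Fin N) :
    Decidable (IsInsertion i o b) := by
  unfold IsInsertion; infer_instance

namespace ShuffleInsertion

variable {n m N : ℕ}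

lemma isInsertion (w : ShuffleInsertion n m N) : IsInsertion w.i w.outer w.inner := by
  refine ⟨⟨fun p q h => w.outer.strictMono h, fun p q h => w.inner.strictMono h⟩,
    ⟨w.isLeast.1, fun j => w.isLeast.2 ⟨j, rfl⟩⟩, fun p q h => ?_, fun a => ?_⟩
  · have : w.outer p ∈ Set.range w.outer ∩ Set.range w.inner := ⟨⟨p, rfl⟩, ⟨q, h.symm⟩⟩
    rw [w.inter] at this
    exact w.outer.injective this
  · have : a ∈ Set.range w.outer ∪ Set.range w.inner := by rw [w.union]; trivial
    exact this

/-- The shuffle insertion with given renumberings. -/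
def ofIsInsertion {i : Fin n} {o : Fin n → Fin N} {b : Fin m → Fin N} (h : IsInsertion i o b) :
    ShuffleInsertion n m N where
  i := i
  outer := OrderEmbedding.ofStrictMono o fun p q => h.1.1 p q
  inner := OrderEmbedding.ofStrictMono b fun p q => h.1.2 p q
  isLeast := ⟨h.2.1.1, by rintro _ ⟨j, rfl⟩; exact h.2.1.2 j⟩
  inter := by
    ext a
    constructor
    · rintro ⟨⟨p, rfl⟩, ⟨q, hq⟩⟩
      have := h.2.2.1 p q hq.symm
      simp [this]
    · rintro rfl
      exact ⟨⟨i, rfl⟩, h.2.1.1⟩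
  union := by
    ext a
    exact ⟨fun _ => trivial, fun _ => h.2.2.2 a⟩

/-- Inclusion-exclusion: the two ranges cover `Fin N` and share exactly one number. -/
lemma card_eq (w : ShuffleInsertion n m N) : n + m = N + 1 := by
  classical
  have h := Finset.card_union_add_card_inter (Finset.univ.image w.outer)
    (Finset.univ.image w.inner)
  have h₁ : Finset.univ.image w.outer ∪ Finset.univ.image w.inner = Finset.univ := by
    ext a
    simpa using w.isInsertion.2.2.2 a
  have h₂ : Finset.univ.image w.outer ∩ Finset.univ.image w.inner = {w.outer w.i} := by
    rw [← Finset.coe_inj]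
    simpa using w.inter
  rw [h₁, h₂, Finset.card_image_of_injective _ w.outer.injective,
    Finset.card_image_of_injective _ w.inner.injective] at h
  simpa using h.symm

/-- The minimum of the inserted block is the new number of the `i`-th input. So the trees grafted at
the inputs have minima given by the increasing map `outer`, and the conditions at the vertices of
`T` persist. -/
lemma isShuffleTree_compTree (w : ShuffleInsertion n m N) {T : OpTree (Fin n)}
    {S : OpTree (Fin m)} (hT : IsShuffleTree T) (hS : IsShuffleTree S) :
    IsShuffleTree (w.compTree T S) := by
  have hmin : w.inner S.minLeaf = w.outer w.i := by
    obtain ⟨j, hj⟩ := w.isLeast.1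
    refine le_antisymm ?_ (w.isLeast.2 ⟨_, rfl⟩)
    rw [← hj]
    exact w.inner.monotone (minLeaf_le (hS.2.1 j))
  refine ⟨?_, fun a => ?_, ?_⟩
  · rw [compTree, leaves_bind, List.nodup_flatMap]
    constructor
    · intro j _
      split_ifs
      · rw [leaves_map]; exact hS.1.map w.inner.injective
      · simp [leaves]
    · refine hT.1.imp fun {p q} hpq => ?_
      -- Disjointness when one of the two inputs is the place of insertion; it is used below in both
      -- directions.
      have key : ∀ p q, p ≠ q → ∀ a ∈ (if p = w.i then S.map w.inner else leaf (w.outer p)).leaves,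
          p = w.i → a ∉ (if q = w.i then S.map w.inner else leaf (w.outer q)).leaves := by
        rintro p q hpq a ha rfl
        rw [if_neg hpq.symm]
        rw [if_pos rfl, leaves_map] at ha
        obtain ⟨j, _, rfl⟩ := List.mem_map.1 ha
        simp only [leaves, List.mem_singleton]
        exact fun h => hpq (w.isInsertion.2.2.1 q j h.symm).symm
      intro a ha ha'
      by_cases hp : p = w.i
      · exact key p q hpq a ha hp ha'
      by_cases hq : q = w.i
      · exact key q p hpq.symm a ha' hq ha
      simp only [if_neg hp, if_neg hq, leaves, List.mem_singleton] at ha ha'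
      exact hpq (w.outer.injective (ha.symm.trans ha'))
  · rw [compTree, leaves_bind, List.mem_flatMap]
    have hinner : ∀ q, ∃ j ∈ T.leaves, w.inner q ∈
        (if j = w.i then S.map w.inner else leaf (w.outer j)).leaves := fun q => by
      refine ⟨w.i, hT.2.1 _, ?_⟩
      rw [if_pos rfl, leaves_map]
      exact List.mem_map_of_mem (hS.2.1 q)
    rcases w.isInsertion.2.2.2 a with ⟨p, rfl⟩ | ⟨q, rfl⟩
    · by_cases hp : p = w.i
      · obtain ⟨q, hq⟩ := w.isLeast.1
        rw [hp, ← hq]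
        exact hinner q
      · exact ⟨p, hT.2.1 p, by simp [hp, leaves]⟩
    · exact hinner q
  · refine isOrdered_bind w.outer.strictMono (fun j => ?_) (fun j => ?_) hT.2.2
    · split_ifs with h
      · rw [minLeaf_map w.inner.strictMono, hmin, h]
      · rfl
    · split_ifs with h
      · exact isOrdered_map w.inner.strictMono hS.2.2
      · trivial

variable {k : Type*} [Field k]

/-- Partial composition as a bilinear map. -/
noncomputable def compBilin (k : Type*) [Field k] (w : ShuffleInsertion n m N) :
    Poly k n →ₗ[k] Poly k m →ₗ[k] Poly k N :=
  Finsupp.linearCombination k fun T =>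
    Finsupp.linearCombination k fun S => Finsupp.single (w.compTree T S) (1 : k)

lemma comp_eq (w : ShuffleInsertion n m N) (f : Poly k n) (g : Poly k m) :
    w.comp f g = w.compBilin k f g := by
  simp [comp, compBilin, Finsupp.linearCombination_apply, Finsupp.sum, LinearMap.sum_apply,
    Finset.smul_sum]

lemma compBilin_single (w : ShuffleInsertion n m N) (T : OpTree (Fin n)) (S : OpTree (Fin m))
    (a b : k) : w.compBilin k (Finsupp.single T a) (Finsupp.single S b) =
      Finsupp.single (w.compTree T S) (a * b) := by
  simp [compBilin]

lemma compBilin_ev_single (w : ShuffleInsertion n m N) (L : List (ℤ × OpTree (Fin n)))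
    (S : OpTree (Fin m)) : w.compBilin k (ev k L) (Finsupp.single S 1) =
      ev k (L.map fun p => (p.1, insTree w.i w.outer w.inner p.2 S)) := by
  induction L with
  | nil => simp
  | cons p L ih =>
    rw [ev_cons, List.map_cons, ev_cons, map_add, LinearMap.add_apply, ih, compBilin_single,
      mul_one]
    rfl

lemma compBilin_single_ev (w : ShuffleInsertion n m N) (T : OpTree (Fin n))
    (L : List (ℤ × OpTree (Fin m))) : w.compBilin k (Finsupp.single T 1) (ev k L) =
      ev k (L.map fun p => (p.1, insTree w.i w.outer w.inner T p.2)) := by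
  induction L with
  | nil => simp
  | cons p L ih =>
    rw [ev_cons, List.map_cons, ev_cons, map_add, ih, compBilin_single, one_mul]
    rfl

end ShuffleInsertion

/-! ### Spanning by tree monomials and closure under composition -/

lemma freeShuffle_eq_span (k : Type*) [Field k] (n : ℕ) : freeShuffle k n =
    Submodule.span k ((fun T => Finsupp.single T (1 : k)) '' {T | IsShuffleTree T}) :=
  Finsupp.supported_eq_span_single k _

lemma single_mem_freeShuffle (k : Type*) [Field k] {n : ℕ} {T : OpTree (Fin n)}
    (h : IsShuffleTree T) (c : k) : Finsupp.single T c ∈ freeShuffle k n :=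
  Finsupp.single_mem_supported k c h

lemma ShuffleInsertion.comp_mem_of_span {k : Type*} [Field k] {n m N : ℕ}
    (w : ShuffleInsertion n m N) {A : Set (Poly k n)} {B : Set (Poly k m)}
    {V : Submodule k (Poly k N)} (h : ∀ f ∈ A, ∀ g ∈ B, w.compBilin k f g ∈ V)
    {f : Poly k n} {g : Poly k m} (hf : f ∈ Submodule.span k A) (hg : g ∈ Submodule.span k B) :
    w.comp f g ∈ V := by
  rw [comp_eq]
  have : Submodule.map₂ (w.compBilin k) (Submodule.span k A) (Submodule.span k B) ≤ V := by
    rw [Submodule.map₂_span_span, Submodule.span_le]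
    rintro _ ⟨f, hf, g, hg, rfl⟩
    exact h f hf g hg
  exact this (Submodule.apply_mem_map₂ _ hf hg)

lemma ShuffleInsertion.comp_mem_freeShuffle {k : Type*} [Field k] {n m N : ℕ}
    (w : ShuffleInsertion n m N) {f : Poly k n} {g : Poly k m} (hf : f ∈ freeShuffle k n)
    (hg : g ∈ freeShuffle k m) : w.comp f g ∈ freeShuffle k N := by
  rw [freeShuffle_eq_span] at hf hg
  refine w.comp_mem_of_span ?_ hf hg
  rintro _ ⟨T, hT, rfl⟩ _ ⟨S, hS, rfl⟩
  rw [compBilin_single]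
  exact single_mem_freeShuffle k (w.isShuffleTree_compTree hT hS) _

/-! ### Composition with the unit -/

/-- By finiteness the embedding is an automorphism of a finite chain, and the identity is the only
one. -/
lemma coe_eq_id_of_orderEmbedding {n : ℕ} (f : Fin n ↪o Fin n) : (f : Fin n → Fin n) = id := by
  have e := Subsingleton.elim
    (RelIso.ofSurjective f (Finite.surjective_of_injective f.injective) : Fin n ≃o Fin n)
    (OrderIso.refl _)
  funext a
  exact DFunLike.congr_fun e a

lemma eq_leaf_of_isShuffleTree_one {T : OpTree (Fin 1)} (h : IsShuffleTree T) : T = leaf 0 := by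
  have := mem_shuffleTrees h
  have e : shuffleTrees 1 = [leaf 0] := by decide
  simpa [e] using this

/-! ### Divisibility and rewriting -/

namespace OpTree

/-- The subtree of `U` that sits at the place of the leaf `a` of `S`. -/
def extract {α β : Type} [DecidableEq α] : OpTree α → OpTree β → α → OpTree β
  | node _ l r, node _ l' r', a => if a ∈ l.leaves then l.extract l' a else r.extract r' a
  | _, U, _ => U

/-- The grafted trees can be read off from the result. This leaves a single candidate for `σ` in
`Divides` at each vertex and makes divisibility decidable. -/
lemma extract_bind {α β : Type} [DecidableEq α] {S : OpTree α} (σ : α → OpTree β) {a : α}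
    (h : a ∈ S.leaves) : S.extract (S.bind σ) a = σ a := by
  induction S with
  | leaf b => simp_all [leaves, bind, extract]
  | node o l r hl hr =>
    simp only [leaves, List.mem_append] at h
    simp only [bind, extract]
    split_ifs with h'
    · exact hl h'
    · exact hr (h.resolve_left h')

end OpTree

/-- Every vertex of `S` is present in `U`, at the same place and with the same label. -/
def fits {α β : Type} : OpTree α → OpTree β → Bool
  | leaf _, _ => true
  | node o l r, node o' l' r' => decide (o = o') && (fits l l' && fits r r')
  | node _ _ _, leaf _ => false

/-- Consequently the condition `fits` in `occursAtRoot` follows from the equality of trees next to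
it; it is a cheap test made first. -/
lemma fits_bind {α β : Type} (S : OpTree α) (σ : α → OpTree β) : fits S (S.bind σ) = true := by
  induction S with
  | leaf a => rfl
  | node o l r hl hr => simp [fits, OpTree.bind, hl, hr]

/-- The tree `S` occurs at the root of `U`. -/
def occursAtRoot {m n : ℕ} (S : OpTree (Fin m)) (U : OpTree (Fin n)) : Bool :=
  fits S U && decide (S.bind (S.extract U) = U) &&
    decide (∀ i j, i < j → (S.extract U i).minLeaf < (S.extract U j).minLeaf)

/-- Divisibility as a Boolean function. -/
def dividesB {m n : ℕ} (S : OpTree (Fin m)) : OpTree (Fin n) → Bool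
  | leaf a => occursAtRoot S (leaf a)
  | node o l r => occursAtRoot S (node o l r) || (dividesB S l || dividesB S r)

lemma Divides.of_dividesB {m n : ℕ} {S : OpTree (Fin m)} {T : OpTree (Fin n)}
    (h : dividesB S T = true) : Divides S T := by
  have root : ∀ U : OpTree (Fin n), occursAtRoot S U = true →
      ∃ σ : Fin m → OpTree (Fin n), StrictMono (fun i => (σ i).minLeaf) ∧ S.bind σ = U := by
    intro U hU
    simp only [occursAtRoot, Bool.and_eq_true, decide_eq_true_eq] at hU
    exact ⟨S.extract U, fun i j => hU.2 i j, hU.1.2⟩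
  induction T with
  | leaf a => exact root _ h
  | node o l r hl hr =>
    simp only [dividesB, Bool.or_eq_true] at h
    rcases h with h | h | h
    · obtain ⟨σ, hσ, e⟩ := root _ h
      exact ⟨σ, hσ, .inl e⟩
    · obtain ⟨σ, hσ, e⟩ := hl h
      exact ⟨σ, hσ, .inr (.inl e)⟩
    · obtain ⟨σ, hσ, e⟩ := hr h
      exact ⟨σ, hσ, .inr (.inr e)⟩

/-- Every input has to occur in `S`: otherwise `σ` is not determined by the grafted tree, and
`extract` need not recover it. -/
lemma Divides.dividesB {m n : ℕ} {S : OpTree (Fin m)} (hS : ∀ i, i ∈ S.leaves)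
    {T : OpTree (Fin n)} (h : Divides S T) : dividesB S T = true := by
  obtain ⟨σ, hσ, h⟩ := h
  have root : occursAtRoot S (S.bind σ) = true := by
    have e : S.extract (S.bind σ) = σ := funext fun i => extract_bind σ (hS i)
    simp only [occursAtRoot, e, fits_bind, decide_true, Bool.true_and, decide_eq_true_eq]
    exact fun i j hij => hσ hij
  induction T with
  | leaf a =>
    simp only [IsSubtree] at h
    rw [h] at root
    exact root
  | node o l r hl hr =>
    simp only [ShuffleGD.dividesB, Bool.or_eq_true]
    rcases h with h | h | h
    · rw [h] at root
      exact .inl root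
    · exact .inr (.inl (hl h))
    · exact .inr (.inr (hr h))

/-- A rewriting rule of arity `n` with integer coefficients. -/
structure IntRule (n : ℕ) where
  lhs : OpTree (Fin n)
  rhs : List (ℤ × OpTree (Fin n))
  deriving DecidableEq

namespace IntRule

variable {m n : ℕ}

/-- The rewriting rule over a field. -/
noncomputable def toRule (k : Type*) [Field k] (r : IntRule n) : Rule k := ⟨n, r.lhs, ev k r.rhs⟩

/-- The relation that the rule stands for. -/
def relation (r : IntRule n) : List (ℤ × OpTree (Fin n)) := (1, r.lhs) :: scale (-1) r.rhs

lemma relation_toRule (k : Type*) [Field k] (r : IntRule n) :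
    (r.toRule k).relation = ev k r.relation := by
  simp [Rule.relation, toRule, relation, mon]
  exact sub_eq_add_neg _ _

/-- Application of the rule at the first place where this is possible. -/
def apply (r : IntRule m) : OpTree (Fin n) → Option (List (ℤ × OpTree (Fin n)))
  | leaf _ => none
  | node o t u =>
    if occursAtRoot r.lhs (node o t u) then
      some (r.rhs.map fun p => (p.1, p.2.bind (r.lhs.extract (node o t u))))
    else match r.apply t with
      | some P => some (P.map fun p => (p.1, node o p.2 u))
      | none => (r.apply u).map fun P => P.map fun p => (p.1, node o t p.2)

end IntRule

/-- The rewriting rules of arity 3. -/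
def intRules₃ : List (IntRule 3) := [
  ⟨X (X v₁ v₃) v₂, [(1, X v₁ (X v₂ v₃))]⟩,
  ⟨X (X v₁ v₂) v₃, [(1, X v₁ (X v₂ v₃))]⟩,
  ⟨Z (X v₁ v₂) v₃, [(2, X (Z v₁ v₃) v₂), (-1, Z v₁ (X v₂ v₃))]⟩,
  ⟨X (Z v₁ v₂) v₃, [(1, X (Z v₁ v₃) v₂), (-1, X v₁ (Z v₂ v₃))]⟩,
  ⟨Z (Z v₁ v₂) v₃, [(1, Z (Z v₁ v₃) v₂), (1, Z v₁ (Z v₂ v₃))]⟩,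
  ⟨Z (X v₁ v₃) v₂, [(2, X (Z v₁ v₃) v₂), (-1, Z v₁ (X v₂ v₃)), (-2, X v₁ (Z v₂ v₃))]⟩]

/-- The rewriting rules of arity 4. -/
def intRules₄ : List (IntRule 4) := [
  ⟨X (Z v₁ v₄) (Z v₂ v₃), [(1, X (Z v₁ v₃) (Z v₂ v₄)), (-1, X (Z v₁ (Z v₃ v₄)) v₂),
    (1, X v₁ (Z v₂ (Z v₃ v₄)))]⟩,
  ⟨X (Z v₁ v₃) (X v₂ v₄), [(1, Z v₁ (X v₂ (X v₃ v₄))), (3, X v₁ (X (Z v₂ v₄) v₃)),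
    (-2, X v₁ (Z v₂ (X v₃ v₄))), (-2, X v₁ (X v₂ (Z v₃ v₄)))]⟩,
  ⟨X (Z v₁ v₄) (X v₂ v₃), [(1, Z v₁ (X v₂ (X v₃ v₄))), (3, X v₁ (X (Z v₂ v₄) v₃)),
    (-2, X v₁ (Z v₂ (X v₃ v₄))), (-1, X v₁ (X v₂ (Z v₃ v₄)))]⟩,
  ⟨X (Z v₁ (X v₃ v₄)) v₂, [(1, Z v₁ (X v₂ (X v₃ v₄))), (2, X v₁ (X (Z v₂ v₄) v₃)),
    (-1, X v₁ (Z v₂ (X v₃ v₄))), (-1, X v₁ (X v₂ (Z v₃ v₄)))]⟩,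
  ⟨Z (Z v₁ v₄) (X v₂ v₃), [(1, Z (Z v₁ (X v₃ v₄)) v₂), (-2, X (Z v₁ v₃) (Z v₂ v₄)),
    (1, Z v₁ (X (Z v₂ v₄) v₃)), (1, Z v₁ (Z v₂ (X v₃ v₄))), (2, X v₁ (Z (Z v₂ v₄) v₃))]⟩,
  ⟨Z (Z v₁ v₃) (X v₂ v₄), [(1, Z (Z v₁ (X v₃ v₄)) v₂), (-2, X (Z v₁ v₃) (Z v₂ v₄)),
    (2, X (Z v₁ (Z v₃ v₄)) v₂), (1, Z v₁ (X (Z v₂ v₄) v₃)), (1, Z v₁ (Z v₂ (X v₃ v₄))),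
    (-1, Z v₁ (X v₂ (Z v₃ v₄))), (2, X v₁ (Z (Z v₂ v₄) v₃))]⟩]

lemma rulesThree_eq (k : Type*) [Field k] :
    rulesThree k = intRules₃.map (IntRule.toRule k) := by
  simp [rulesThree, intRules₃, IntRule.toRule, sub_eq_add_neg, add_assoc]

lemma rulesFour_eq (k : Type*) [Field k] :
    rulesFour k = intRules₄.map (IntRule.toRule k) := by
  simp [rulesFour, intRules₄, IntRule.toRule, sub_eq_add_neg, add_assoc]

/-- One rewriting step. -/
def rewrite {n : ℕ} (T : OpTree (Fin n)) : Option (List (ℤ × OpTree (Fin n))) :=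
  (intRules₃.findSome? fun r => r.apply T).orElse fun _ => intRules₄.findSome? fun r => r.apply T

/-- The formal sum obtained from a tree by at most a given number of successive rewriting steps. -/
def normalForm {n : ℕ} : ℕ → OpTree (Fin n) → List (ℤ × OpTree (Fin n))
  | 0, T => [(1, T)]
  | b + 1, T => match rewrite T with
    | none => [(1, T)]
    | some P => extend (normalForm b) P

/-- A left-hand side of the list divides `T`. -/
def isReducible {n : ℕ} (T : OpTree (Fin n)) : Bool :=
  (intRules₃.any fun r => dividesB r.lhs T) || intRules₄.any fun r => dividesB r.lhs T

/-! ### Identities of degree 3 -/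

/-- The shuffle form of an identity with renamed variables. -/
def permute (s : Fin 3 → Fin 3) (L : List (ℤ × OpTree (Fin 3))) : List (ℤ × OpTree (Fin 3)) :=
  L.map fun p => ((p.2.map s).shuffleSign * p.1, (p.2.map s).toShuffle)

lemma shuffleForm_eq {k : Type*} [Field k] {n : ℕ} (f : Poly k n) : shuffleForm f =
    Finsupp.linearCombination k (fun T => Finsupp.single T.toShuffle (T.shuffleSign : k)) f := by
  simp [shuffleForm, Finsupp.linearCombination_apply, mul_comm]

lemma shuffleForm_mapDomain_ev (k : Type*) [Field k] (s : Fin 3 → Fin 3)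
    (L : List (ℤ × OpTree (Fin 3))) :
    shuffleForm ((ev k L).mapDomain (OpTree.map s)) = ev k (permute s L) := by
  rw [shuffleForm_eq]
  induction L with
  | nil => simp [permute]
  | cons p L ih =>
    rw [ev_cons, Finsupp.mapDomain_add, map_add, ih, Finsupp.mapDomain_single]
    simp [permute, mul_comm]

/-- `(x₁ x₂) x₃ = x₁ (x₂ x₃)` -/
def intAssoc : List (ℤ × OpTree (Fin 3)) := [(1, X (X v₁ v₂) v₃), (-1, X v₁ (X v₂ v₃))]

/-- `(x₁ x₂) x₃ - x₁ (x₂ x₃) = (x₂ x₁) x₃ - x₂ (x₁ x₃)` -/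
def intLeftSym : List (ℤ × OpTree (Fin 3)) :=
  [(1, X (X v₁ v₂) v₃), (-1, X v₁ (X v₂ v₃)), (-1, X (X v₂ v₁) v₃), (1, X v₂ (X v₁ v₃))]

/-- `(x₁ x₂) x₃ = (x₁ x₃) x₂` -/
def intRightCom : List (ℤ × OpTree (Fin 3)) := [(1, X (X v₁ v₂) v₃), (-1, X (X v₁ v₃) v₂)]

/-- The Jacobi identity. -/
def intJacobi : List (ℤ × OpTree (Fin 3)) :=
  [(1, Z (Z v₁ v₂) v₃), (1, Z (Z v₂ v₃) v₁), (1, Z (Z v₃ v₁) v₂)]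

/-- The Gelfand-Dorfman identity. -/
def intGD : List (ℤ × OpTree (Fin 3)) :=
  [(1, Z v₁ (X v₂ v₃)), (-1, Z v₃ (X v₂ v₁)), (1, X (Z v₂ v₁) v₃), (-1, X (Z v₂ v₃) v₁),
    (-1, X v₂ (Z v₁ v₃))]

/-- The transposed Leibniz identity. -/
def intTP : List (ℤ × OpTree (Fin 3)) :=
  [(2, X (Z v₁ v₂) v₃), (-1, Z (X v₁ v₃) v₂), (-1, Z v₁ (X v₂ v₃))]

section

variable (k : Type*) [Field k]

lemma comGD_identities_eq : {leftSymId k, rightComId k, jacobiId k, gdId k} =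
    {f | ∃ L ∈ [intLeftSym, intRightCom, intJacobi, intGD], f = ev k L} := by
  have h₁ : leftSymId k = ev k intLeftSym := by
    simp [leftSymId, intLeftSym]
    abel
  have h₂ : rightComId k = ev k intRightCom := by
    simp [rightComId, intRightCom, sub_eq_add_neg]
  have h₃ : jacobiId k = ev k intJacobi := by simp [jacobiId, intJacobi, add_assoc]
  have h₄ : gdId k = ev k intGD := by simp [gdId, intGD, sub_eq_add_neg, add_assoc]
  ext f
  simp [h₁, h₂, h₃, h₄]

lemma transposedPoisson_identities_eq : {assocId k, jacobiId k, tpId k} =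
    {f | ∃ L ∈ [intAssoc, intJacobi, intTP], f = ev k L} := by
  have h₁ : assocId k = ev k intAssoc := by simp [assocId, intAssoc, sub_eq_add_neg]
  have h₃ : jacobiId k = ev k intJacobi := by simp [jacobiId, intJacobi, add_assoc]
  have h₄ : tpId k = ev k intTP := by
    simp [tpId, intTP, sub_eq_add_neg, add_comm]
  ext f
  simp [h₁, h₃, h₄]

/-- The relations of arity 3 given by the rewriting rules. -/
def baseRelations : Set (Poly k 3) := {f | ∃ r ∈ intRules₃, f = ev k r.relation}

end

/-- The linear combination of the relations of arity 3 that has the same coefficients as `L` at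
the left-hand sides of the rules. -/
def baseCombination (L : List (ℤ × OpTree (Fin 3))) : List (ℤ × OpTree (Fin 3)) :=
  intRules₃.flatMap fun r => scale (coef L r.lhs) r.relation

section

variable {k : Type*} [Field k]

lemma ev_flatMap_scale_mem {α β : Type} {V : Submodule k (α →₀ k)} (C : List β) (c : β → ℤ)
    (M : β → List (ℤ × α)) (h : ∀ b ∈ C, ev k (M b) ∈ V) :
    ev k (C.flatMap fun b => scale (c b) (M b)) ∈ V := by
  induction C with
  | nil => simp
  | cons b C ih =>
    rw [List.flatMap_cons, ev_append, ev_scale]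
    exact V.add_mem (V.smul_mem _ (h b (by simp))) (ih fun b hb => h b (by simp [hb]))

/-- Certificates may have a denominator `d`: the integer identity `d L = M` is checked, and `d` is
invertible in characteristic 0. -/
lemma ev_mem_of_isZero [CharZero k] {α : Type} [DecidableEq α] {V : Submodule k (α →₀ k)} {d : ℤ}
    {L M : List (ℤ × α)} (hd : d ≠ 0) (h : isZero (scale d L ++ scale (-1) M) = true)
    (hM : ev k M ∈ V) : ev k L ∈ V := by
  have e := ev_eq_zero k h
  rw [ev_append, ev_scale, ev_scale, Int.cast_neg, Int.cast_one, neg_one_smul, ← sub_eq_add_neg,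
    sub_eq_zero] at e
  rw [← e] at hM
  exact (V.smul_mem_iff (Int.cast_ne_zero.2 hd)).1 hM

end

section

variable (k : Type*) [Field k] [CharZero k]

/-- Each left-hand side occurs in just one basic relation, so an element of their span equals its
`baseCombination`. Membership thus becomes a test without any search for coefficients. -/
lemma span_shuffleRelations_le {E : Set (Poly k 3)} {A : List (List (ℤ × OpTree (Fin 3)))}
    (hE : E = {f | ∃ L ∈ A, f = ev k L})
    (h : ∀ L ∈ A, ∀ a b c : Fin 3, a ≠ b → a ≠ c → b ≠ c →
      isZero (scale 1 (permute ![a, b, c] L) ++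
        scale (-1) (baseCombination (permute ![a, b, c] L))) = true) :
    Submodule.span k (shuffleRelations E) ≤ Submodule.span k (baseRelations k) := by
  rw [Submodule.span_le]
  rintro _ ⟨_, hf, σ, rfl⟩
  rw [hE] at hf
  obtain ⟨L, hL, rfl⟩ := hf
  rw [shuffleForm_mapDomain_ev]
  -- The finite check ranges over triples of distinct values, so the permutation is written as such
  -- a triple.
  have e : (σ : Fin 3 → Fin 3) = ![σ 0, σ 1, σ 2] := by
    funext i; fin_cases i <;> rfl
  rw [e]
  refine ev_mem_of_isZero one_ne_zero (h L hL _ _ _ ?_ ?_ ?_) ?_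
  · exact σ.injective.ne (by decide)
  · exact σ.injective.ne (by decide)
  · exact σ.injective.ne (by decide)
  · exact ev_flatMap_scale_mem _ _ _ fun r hr => Submodule.subset_span ⟨r, hr, rfl⟩

/-- The table `C` holds, for each basic relation, a denominator and a combination of identities with
renamed variables. -/
lemma le_span_shuffleRelations {E : Set (Poly k 3)} {A : List (List (ℤ × OpTree (Fin 3)))}
    (hE : E = {f | ∃ L ∈ A, f = ev k L})
    (C : Fin 6 → ℤ × List (ℤ × List (ℤ × OpTree (Fin 3)) × (Fin 3 → Fin 3)))
    (h : ∀ i : Fin 6, (C i).1 ≠ 0 ∧ (∀ c ∈ (C i).2, c.2.1 ∈ A ∧ ∀ p q, c.2.2 p = c.2.2 q → p = q) ∧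
      isZero (scale (C i).1 (intRules₃.get i).relation ++
        scale (-1) ((C i).2.flatMap fun c => scale c.1 (permute c.2.2 c.2.1))) = true) :
    Submodule.span k (baseRelations k) ≤ Submodule.span k (shuffleRelations E) := by
  rw [Submodule.span_le]
  rintro _ ⟨r, hr, rfl⟩
  obtain ⟨i, rfl⟩ := List.mem_iff_get.1 hr
  obtain ⟨hd, hC, hz⟩ := h i
  refine ev_mem_of_isZero hd hz (ev_flatMap_scale_mem _ _ _ fun c hc => Submodule.subset_span ?_)
  obtain ⟨hA, hinj⟩ := hC c hc
  refine ⟨ev k c.2.1, ?_, Equiv.ofBijective c.2.2 (Finite.injective_iff_bijective.1 hinj), ?_⟩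
  · rw [hE]
    exact ⟨_, hA, rfl⟩
  · exact (shuffleForm_mapDomain_ev k _ _).symm

lemma span_comGD : Submodule.span k (shuffleRelations {leftSymId k, rightComId k, jacobiId k,
    gdId k}) = Submodule.span k (baseRelations k) := by
  refine le_antisymm (span_shuffleRelations_le k (comGD_identities_eq k) (by decide +kernel))
    (le_span_shuffleRelations k (comGD_identities_eq k)
      -- Left symmetry yields both associativity rules. The third entry is the transposed Leibniz
      -- identity with renamed variables; the fourth is the cyclic identity, in which all brackets
      -- with products cancel.
      ![(1, [(1, intLeftSym, ![0, 1, 2])]),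
        (1, [(1, intLeftSym, ![0, 2, 1])]),
        (1, [(1, intGD, ![1, 0, 2]), (1, intGD, ![0, 2, 1])]),
        (1, [(1, intGD, ![1, 0, 2]), (-1, intGD, ![0, 1, 2]), (1, intGD, ![0, 2, 1])]),
        (1, [(1, intJacobi, ![0, 1, 2])]),
        (1, [(2, intGD, ![0, 2, 1]), (1, intGD, ![1, 0, 2]), (-1, intGD, ![0, 1, 2])])]
      (by decide +kernel))

lemma span_transposedPoisson : Submodule.span k (shuffleRelations {assocId k, jacobiId k,
    tpId k}) = Submodule.span k (baseRelations k) := by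
  refine le_antisymm
    (span_shuffleRelations_le k (transposedPoisson_identities_eq k) (by decide +kernel))
    (le_span_shuffleRelations k (transposedPoisson_identities_eq k)
      ![(1, [(1, intAssoc, ![0, 2, 1])]),
        (1, [(1, intAssoc, ![0, 1, 2])]),
        (1, [(-1, intTP, ![0, 2, 1])]),
        -- The cyclic sum of the transposed Leibniz identity, one term rewritten by antisymmetry in
        -- its bracket arguments. It is twice the cyclic identity, whence the denominator 2.
        (2, [(1, intTP, ![1, 2, 0]), (-1, intTP, ![0, 2, 1]), (1, intTP, ![0, 1, 2])]),
        (1, [(1, intJacobi, ![0, 1, 2])]),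
        (1, [(1, intTP, ![1, 2, 0]), (-1, intTP, ![0, 2, 1])])]
      (by decide +kernel))

end

/-- The arity 3 part of an ideal is a subspace, so it contains a set exactly when it contains the
span. -/
lemma generatedIdeal_congr {k : Type*} [Field k] {R R' : Set (Poly k 3)}
    (h : Submodule.span k R = Submodule.span k R') : generatedIdeal R = generatedIdeal R' := by
  have key : ∀ V : Submodule k (Poly k 3), R ⊆ V ↔ R' ⊆ V := fun V => by
    rw [← Submodule.span_le, h, Submodule.span_le]
  funext n
  simp only [generatedIdeal, key]

lemma mem_generatedIdeal {k : Type*} [Field k] {R : Set (Poly k 3)} {n : ℕ} {f : Poly k n} :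
    f ∈ generatedIdeal R n ↔ ∀ I : ∀ n, Submodule k (Poly k n), IsShuffleIdeal I → R ⊆ I 3 →
      f ∈ I n := by
  simp only [generatedIdeal, Submodule.mem_sInf, Set.mem_ofPred_eq]
  constructor
  · exact fun h I hI hR => h _ ⟨I, hI, hR, rfl⟩
  · rintro h _ ⟨I, hI, hR, rfl⟩
    exact h I hI hR

lemma comGDIdeal_eq (k : Type*) [Field k] [CharZero k] :
    comGDIdeal k = generatedIdeal (baseRelations k) :=
  generatedIdeal_congr (span_comGD k)

lemma transposedPoissonIdeal_eq (k : Type*) [Field k] [CharZero k] :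
    transposedPoissonIdeal k = generatedIdeal (baseRelations k) :=
  generatedIdeal_congr (span_transposedPoisson k)

/-! ### Finite verifications -/

/-- The consequence of a formal sum of arity 3 that arises by inserting a generator. -/
def insertGenerator (i : Fin 3) (o : Fin 3 → Fin 4) (b : Fin 2 → Fin 4)
    (L : List (ℤ × OpTree (Fin 3))) (S : OpTree (Fin 2)) : List (ℤ × OpTree (Fin 4)) :=
  L.map fun p => (p.1, insTree i o b p.2 S)

/-- The consequence of a formal sum of arity 3 that arises by inserting it into a generator. -/
def insertIntoGenerator (i : Fin 2) (o : Fin 2 → Fin 4) (b : Fin 3 → Fin 4)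
    (T : OpTree (Fin 2)) (L : List (ℤ × OpTree (Fin 3))) : List (ℤ × OpTree (Fin 4)) :=
  L.map fun p => (p.1, insTree i o b T p.2)

lemma isZero_normalForm_relation :
    ∀ r ∈ intRules₃, isZero (extend (normalForm 5) r.relation) = true := by decide +kernel

/-- Together with `isZero_normalForm_insertIntoGenerator` this replaces the reduction of
S-polynomials: all consequences of the basic relations in arity 4 are tested directly. -/
lemma isZero_normalForm_insertGenerator : ∀ (i : Fin 3) (o₀ o₁ o₂ : Fin 4) (b₀ b₁ : Fin 4),
    IsInsertion i ![o₀, o₁, o₂] ![b₀, b₁] → ∀ r ∈ intRules₃, ∀ S ∈ shuffleTrees 2,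
      isZero (extend (normalForm 5)
        (insertGenerator i ![o₀, o₁, o₂] ![b₀, b₁] r.relation S)) = true := by
  decide +kernel

lemma isZero_normalForm_insertIntoGenerator : ∀ (i : Fin 2) (o₀ o₁ : Fin 4) (b₀ b₁ b₂ : Fin 4),
    IsInsertion i ![o₀, o₁] ![b₀, b₁, b₂] → ∀ r ∈ intRules₃, ∀ S ∈ shuffleTrees 2,
      isZero (extend (normalForm 5)
        (insertIntoGenerator i ![o₀, o₁] ![b₀, b₁, b₂] S r.relation)) = true := by
  decide +kernel

/-- The rewriting rules are compatible with the order on the shuffle trees of arity `n`, and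
rewriting changes all trees that are divisible by a left-hand side, and only these. -/
def RewritingIsCompatible (n : ℕ) : Prop :=
  ∀ T ∈ shuffleTrees n, (isReducible T = true ∨ normalForm 5 T = [(1, T)]) ∧
    (∀ p ∈ normalForm 5 T, orderKey p.2 ≤ orderKey T)

/-- Shuffle trees of arity `n` are determined by their keys. -/
def KeysAreDistinct (n : ℕ) : Prop := ((shuffleTrees n).map orderKey).Nodup

/-- Full reduction after 5 steps is nowhere needed: it is enough that irreducible trees are fixed
and that no tree is sent to a larger one. -/
lemma rewritingIsCompatible_three : RewritingIsCompatible 3 := by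
  unfold RewritingIsCompatible; decide +kernel

lemma rewritingIsCompatible_four : RewritingIsCompatible 4 := by
  unfold RewritingIsCompatible; decide +kernel

lemma keysAreDistinct_three : KeysAreDistinct 3 := by
  unfold KeysAreDistinct; decide +kernel

lemma keysAreDistinct_four : KeysAreDistinct 4 := by
  unfold KeysAreDistinct; decide +kernel

/-! ### The rules of arity 4 lie in the ideal -/

/-- The six ways to insert a generator into an operation of arity 3. -/
def inner₂ : Fin 6 → Fin 3 × (Fin 3 → Fin 4) × (Fin 2 → Fin 4) :=
  ![(0, ![0, 2, 3], ![0, 1]), (0, ![0, 1, 3], ![0, 2]), (0, ![0, 1, 2], ![0, 3]),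
    (1, ![0, 1, 3], ![1, 2]), (1, ![0, 1, 2], ![1, 3]), (2, ![0, 1, 2], ![2, 3])]

/-- The four ways to insert an operation of arity 3 into a generator. -/
def inner₃ : Fin 4 → Fin 2 × (Fin 2 → Fin 4) × (Fin 3 → Fin 4) :=
  ![(0, ![0, 3], ![0, 1, 2]), (0, ![0, 2], ![0, 1, 3]), (0, ![0, 1], ![0, 2, 3]),
    (1, ![0, 1], ![1, 2, 3])]

/-- A multiple of each rule of arity 4 as a linear combination of compositions of rules of arity 3
with generators. The entries of the two lists are the coefficient, the renumbering, the rule, and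
the generator. -/
def compositions₄ : Fin 6 → ℤ × List (ℤ × Fin 6 × Fin 6 × OpTree (Fin 2)) ×
    List (ℤ × Fin 4 × Fin 6 × OpTree (Fin 2)) :=
  ![(2,
    [(1, 0, 3, Z v₁ v₂), (-1, 1, 3, Z v₁ v₂), (1, 2, 3, Z v₁ v₂), (-1, 3, 3, Z v₁ v₂),
      (1, 4, 3, Z v₁ v₂), (-1, 5, 3, Z v₁ v₂)],
    [(-1, 0, 4, X v₁ v₂), (1, 1, 4, X v₁ v₂), (-1, 2, 4, X v₁ v₂), (1, 3, 4, X v₁ v₂)]),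
  (2,
    [(2, 0, 0, Z v₁ v₂), (1, 0, 2, X v₁ v₂), (2, 2, 1, Z v₁ v₂), (-1, 3, 2, X v₁ v₂),
      (2, 4, 1, Z v₁ v₂), (-2, 4, 3, X v₁ v₂), (-1, 5, 2, X v₁ v₂), (2, 5, 3, X v₁ v₂)],
    [(-1, 0, 1, Z v₁ v₂), (2, 1, 2, X v₁ v₂), (-2, 1, 3, X v₁ v₂), (1, 3, 1, Z v₁ v₂),
      (2, 3, 5, X v₁ v₂)]),
  (2,
    [(4, 1, 0, Z v₁ v₂), (2, 2, 2, X v₁ v₂), (-1, 2, 5, X v₁ v₂), (2, 3, 0, Z v₁ v₂),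
      (-1, 3, 5, X v₁ v₂), (-2, 4, 2, X v₁ v₂), (1, 5, 5, X v₁ v₂)],
    [(-2, 1, 0, Z v₁ v₂), (1, 2, 0, Z v₁ v₂), (-4, 2, 3, X v₁ v₂), (2, 2, 5, X v₁ v₂),
      (2, 3, 0, Z v₁ v₂), (1, 3, 1, Z v₁ v₂), (2, 3, 2, X v₁ v₂), (2, 3, 3, X v₁ v₂)]),
  (2,
    [(2, 1, 0, Z v₁ v₂), (1, 1, 2, X v₁ v₂), (2, 2, 0, Z v₁ v₂), (-1, 3, 2, X v₁ v₂),
      (-1, 4, 5, X v₁ v₂), (2, 5, 0, Z v₁ v₂)],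
    [(-1, 0, 0, Z v₁ v₂), (2, 2, 2, X v₁ v₂), (-2, 2, 3, X v₁ v₂), (1, 3, 0, Z v₁ v₂),
      (1, 3, 1, Z v₁ v₂), (2, 3, 5, X v₁ v₂)]),
  (1,
    [(-2, 0, 2, Z v₁ v₂), (1, 1, 4, X v₁ v₂), (-4, 2, 3, Z v₁ v₂), (2, 2, 5, Z v₁ v₂),
      (1, 3, 4, X v₁ v₂), (-4, 4, 3, Z v₁ v₂), (1, 4, 5, Z v₁ v₂), (2, 5, 4, X v₁ v₂)],
    [(2, 0, 3, Z v₁ v₂), (-1, 0, 5, Z v₁ v₂), (-4, 1, 4, X v₁ v₂), (1, 2, 2, Z v₁ v₂),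
      (1, 3, 2, Z v₁ v₂)]),
  (1,
    [(-1, 0, 2, Z v₁ v₂), (1, 1, 2, Z v₁ v₂), (-2, 2, 3, Z v₁ v₂), (-1, 3, 2, Z v₁ v₂),
      (-2, 4, 3, Z v₁ v₂), (1, 5, 4, X v₁ v₂)],
    [(1, 0, 3, Z v₁ v₂), (-2, 1, 4, X v₁ v₂), (2, 2, 4, X v₁ v₂), (1, 3, 3, Z v₁ v₂)])]

/-- The value of an entry of the first list of `compositions₄`. -/
def composition₂ (c : ℤ × Fin 6 × Fin 6 × OpTree (Fin 2)) : List (ℤ × OpTree (Fin 4)) :=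
  insertGenerator (inner₂ c.2.1).1 (inner₂ c.2.1).2.1 (inner₂ c.2.1).2.2
    (intRules₃.get c.2.2.1).relation c.2.2.2

/-- The value of an entry of the second list of `compositions₄`. -/
def composition₃ (c : ℤ × Fin 4 × Fin 6 × OpTree (Fin 2)) : List (ℤ × OpTree (Fin 4)) :=
  insertIntoGenerator (inner₃ c.2.1).1 (inner₃ c.2.1).2.1 (inner₃ c.2.1).2.2 c.2.2.2
    (intRules₃.get c.2.2.1).relation

/-- The stored coefficients solve a linear system; only the resulting identity of formal sums has to
be checked. -/
lemma compositions₄_spec : ∀ i : Fin 6, (compositions₄ i).1 ≠ 0 ∧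
    (∀ c ∈ (compositions₄ i).2.1, IsShuffleTree c.2.2.2) ∧
    (∀ c ∈ (compositions₄ i).2.2, IsShuffleTree c.2.2.2) ∧
    isZero (scale (compositions₄ i).1 (intRules₄.get i).relation ++ scale (-1)
      ((compositions₄ i).2.1.flatMap (fun c => scale c.1 (composition₂ c)) ++
        (compositions₄ i).2.2.flatMap fun c => scale c.1 (composition₃ c))) = true := by
  decide +kernel

section Ideal

variable {k : Type*} [Field k] {I : ∀ n, Submodule k (Poly k n)}

lemma IsShuffleIdeal.insertGenerator_mem (hI : IsShuffleIdeal I) {i : Fin 3}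
    {o : Fin 3 → Fin 4} {b : Fin 2 → Fin 4} (h : IsInsertion i o b)
    {L : List (ℤ × OpTree (Fin 3))} (hL : ev k L ∈ I 3) {S : OpTree (Fin 2)}
    (hS : IsShuffleTree S) : ev k (insertGenerator i o b L S) ∈ I 4 := by
  have := hI.comp_left (.ofIsInsertion h) _ _ hL (single_mem_freeShuffle k hS 1)
  rwa [ShuffleInsertion.comp_eq, ShuffleInsertion.compBilin_ev_single] at this

lemma IsShuffleIdeal.insertIntoGenerator_mem (hI : IsShuffleIdeal I) {i : Fin 2}
    {o : Fin 2 → Fin 4} {b : Fin 3 → Fin 4} (h : IsInsertion i o b)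
    {L : List (ℤ × OpTree (Fin 3))} (hL : ev k L ∈ I 3) {S : OpTree (Fin 2)}
    (hS : IsShuffleTree S) : ev k (insertIntoGenerator i o b S L) ∈ I 4 := by
  have := hI.comp_right (.ofIsInsertion h) _ _ (single_mem_freeShuffle k hS 1) hL
  rwa [ShuffleInsertion.comp_eq, ShuffleInsertion.compBilin_single_ev] at this

lemma IsShuffleIdeal.relation_mem [CharZero k] (hI : IsShuffleIdeal I)
    (hR : baseRelations k ⊆ I 3) {r : IntRule 4} (hr : r ∈ intRules₄) :
    ev k r.relation ∈ I 4 := by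
  obtain ⟨i, rfl⟩ := List.mem_iff_get.1 hr
  obtain ⟨hd, h₂, h₃, hz⟩ := compositions₄_spec i
  refine ev_mem_of_isZero hd hz ?_
  have hbase : ∀ j, ev k (intRules₃.get j).relation ∈ I 3 := fun j =>
    hR ⟨_, List.get_mem _ _, rfl⟩
  have i₂ : ∀ j, IsInsertion (inner₂ j).1 (inner₂ j).2.1 (inner₂ j).2.2 := by decide +kernel
  have i₃ : ∀ j, IsInsertion (inner₃ j).1 (inner₃ j).2.1 (inner₃ j).2.2 := by decide +kernel
  rw [ev_append]
  refine Submodule.add_mem _ (ev_flatMap_scale_mem _ _ _ fun c hc => ?_)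
    (ev_flatMap_scale_mem _ _ _ fun c hc => ?_)
  · exact hI.insertGenerator_mem (i₂ _) (hbase _) (h₂ c hc)
  · exact hI.insertIntoGenerator_mem (i₃ _) (hbase _) (h₃ c hc)

end Ideal

/-! ### An ideal that contains the relations -/

section Truncation

variable (k : Type*) [Field k]

/-- The linear combinations of shuffle trees with normal form zero. -/
noncomputable def normalFormKer (n : ℕ) : Submodule k (Poly k n) :=
  freeShuffle k n ⊓ LinearMap.ker (evLinear k (normalForm (n := n) 5))

/-- An ideal that contains the relations of arity 3, is small in arity 4, and contains everything
in higher arities. -/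
noncomputable def truncatedIdeal : ∀ n, Submodule k (Poly k n)
  | 0 => ⊥
  | 1 => ⊥
  | 2 => ⊥
  | 3 => Submodule.span k (baseRelations k)
  | 4 => normalFormKer k 4
  | _ + 5 => freeShuffle k _

lemma truncatedIdeal_of_lt {n : ℕ} (hn : n < 3) : truncatedIdeal k n = ⊥ := by
  interval_cases n <;> rfl

lemma truncatedIdeal_of_gt {n : ℕ} (hn : 4 < n) : truncatedIdeal k n = freeShuffle k n := by
  obtain ⟨n, rfl⟩ := Nat.exists_eq_add_of_lt hn
  rw [show 4 + n + 1 = n + 5 by omega]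
  rfl

lemma span_baseRelations_le : Submodule.span k (baseRelations k) ≤ normalFormKer k 3 := by
  rw [Submodule.span_le]
  rintro _ ⟨r, hr, rfl⟩
  constructor
  · refine ev_mem k fun p hp => single_mem_freeShuffle k ?_ 1
    have : ∀ r ∈ intRules₃, ∀ p ∈ r.relation, IsShuffleTree p.2 := by decide +kernel
    exact this r hr p hp
  · rw [SetLike.mem_coe, LinearMap.mem_ker, evLinear_ev]
    exact ev_eq_zero k (isZero_normalForm_relation r hr)

lemma truncatedIdeal_le_free (n : ℕ) : truncatedIdeal k n ≤ freeShuffle k n := by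
  rcases lt_or_ge n 3 with hn | hn
  · rw [truncatedIdeal_of_lt k hn]; exact bot_le
  rcases lt_or_ge 4 n with hn' | hn'
  · rw [truncatedIdeal_of_gt k hn']
  interval_cases n
  · exact (span_baseRelations_le k).trans inf_le_left
  · exact inf_le_left

lemma freeShuffle_le_span (n : ℕ) : freeShuffle k n ≤
    Submodule.span k {f | ∃ T ∈ shuffleTrees n, f = Finsupp.single T 1} := by
  rw [freeShuffle_eq_span]
  refine Submodule.span_mono ?_
  rintro _ ⟨T, hT, rfl⟩
  exact ⟨T, mem_shuffleTrees hT, rfl⟩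

lemma eq_smul_of_mem_freeShuffle_one {k : Type*} [Field k] {f : Poly k 1}
    (h : f ∈ freeShuffle k 1) : ∃ c : k, f = Finsupp.single (leaf 0) c := by
  refine ⟨f (leaf 0), ?_⟩
  rw [← Finsupp.support_subset_singleton]
  intro T hT
  rw [eq_leaf_of_isShuffleTree_one (h hT)]
  simp

lemma ShuffleInsertion.comp_unit {k : Type*} [Field k] {n : ℕ} (w : ShuffleInsertion n 1 n)
    (f : Poly k n) (c : k) : w.comp f (Finsupp.single (leaf 0) c) = c • f := by
  have hw : ∀ T : OpTree (Fin n), w.compTree T (leaf 0) = T := by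
    intro T
    have : (fun j => if j = w.i then (leaf 0 : OpTree (Fin 1)).map w.inner
        else leaf (w.outer j)) = leaf := by
      have ho := coe_eq_id_of_orderEmbedding w.outer
      obtain ⟨q, hq⟩ := w.isLeast.1
      rw [Subsingleton.elim q 0] at hq
      funext j
      split_ifs with h
      · simp [OpTree.map, OpTree.bind, hq, ho, h]
      · simp [ho]
    rw [compTree, this, bind_leaf]
  induction f using Finsupp.induction_linear with
  | zero => simp [comp_eq]
  | add f g hf hg => rw [comp_eq] at *; rw [map_add, LinearMap.add_apply, hf, hg, smul_add]
  | single T a => rw [comp_eq, compBilin_single, hw, Finsupp.smul_single, smul_eq_mul, mul_comm]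

lemma ShuffleInsertion.unit_comp {k : Type*} [Field k] {n : ℕ} (w : ShuffleInsertion 1 n n)
    (f : Poly k n) (c : k) : w.comp (Finsupp.single (leaf 0) c) f = c • f := by
  have hw : ∀ T : OpTree (Fin n), w.compTree (leaf 0) T = T := by
    intro T
    simp only [compTree, OpTree.bind, Subsingleton.elim w.i 0, if_true,
      coe_eq_id_of_orderEmbedding w.inner]
    exact map_id' T
  induction f using Finsupp.induction_linear with
  | zero => simp [comp_eq]
  | add f g hf hg => rw [comp_eq] at *; rw [map_add, hf, hg, smul_add]
  | single T a => rw [comp_eq, compBilin_single, hw, Finsupp.smul_single, smul_eq_mul]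

lemma comp_generator_mem {f : Poly k 3} {g : Poly k 2} (w : ShuffleInsertion 3 2 4)
    (hf : f ∈ Submodule.span k (baseRelations k)) (hg : g ∈ freeShuffle k 2) :
    w.comp f g ∈ normalFormKer k 4 := by
  refine ⟨w.comp_mem_freeShuffle (truncatedIdeal_le_free k 3 hf) hg, ?_⟩
  refine w.comp_mem_of_span ?_ hf (freeShuffle_le_span k 2 hg)
  rintro _ ⟨r, hr, rfl⟩ _ ⟨S, hS, rfl⟩
  rw [ShuffleInsertion.compBilin_ev_single, LinearMap.mem_ker, evLinear_ev]
  have ho : (w.outer : Fin 3 → Fin 4) = ![w.outer 0, w.outer 1, w.outer 2] := by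
    funext j; fin_cases j <;> rfl
  have hb : (w.inner : Fin 2 → Fin 4) = ![w.inner 0, w.inner 1] := by
    funext j; fin_cases j <;> rfl
  have hw := w.isInsertion
  rw [ho, hb] at hw ⊢
  exact ev_eq_zero k (isZero_normalForm_insertGenerator _ _ _ _ _ _ hw r hr S hS)

lemma generator_comp_mem {f : Poly k 2} {g : Poly k 3} (w : ShuffleInsertion 2 3 4)
    (hf : f ∈ freeShuffle k 2) (hg : g ∈ Submodule.span k (baseRelations k)) :
    w.comp f g ∈ normalFormKer k 4 := by
  refine ⟨w.comp_mem_freeShuffle hf (truncatedIdeal_le_free k 3 hg), ?_⟩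
  refine w.comp_mem_of_span ?_ (freeShuffle_le_span k 2 hf) hg
  rintro _ ⟨S, hS, rfl⟩ _ ⟨r, hr, rfl⟩
  rw [ShuffleInsertion.compBilin_single_ev, LinearMap.mem_ker, evLinear_ev]
  have ho : (w.outer : Fin 2 → Fin 4) = ![w.outer 0, w.outer 1] := by
    funext j; fin_cases j <;> rfl
  have hb : (w.inner : Fin 3 → Fin 4) = ![w.inner 0, w.inner 1, w.inner 2] := by
    funext j; fin_cases j <;> rfl
  have hw := w.isInsertion
  rw [ho, hb] at hw ⊢
  exact ev_eq_zero k (isZero_normalForm_insertIntoGenerator _ _ _ _ _ _ hw r hr S hS)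

lemma isShuffleIdeal_truncatedIdeal : IsShuffleIdeal (truncatedIdeal k) where
  le_free := truncatedIdeal_le_free k
  comp_left := by
    intro n m N w f g hf hg
    have hc := w.card_eq
    rcases lt_or_ge n 3 with hn | hn
    · rw [truncatedIdeal_of_lt k hn, Submodule.mem_bot] at hf
      simp [hf, ShuffleInsertion.comp_eq]
    rcases lt_or_ge 4 N with hN | hN
    · rw [truncatedIdeal_of_gt k hN]
      exact w.comp_mem_freeShuffle (truncatedIdeal_le_free k n hf) hg
    -- The inserted block is not empty, so `m ≥ 1`; with `n ≥ 3` and `n + m = N + 1 ≤ 5` only the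
    -- unit and the generators can be inserted.
    obtain ⟨q, -⟩ := w.isLeast.1
    have hm := q.pos
    obtain rfl | rfl : m = 1 ∨ m = 2 := by omega
    · obtain rfl : n = N := by omega
      obtain ⟨c, rfl⟩ := eq_smul_of_mem_freeShuffle_one hg
      rw [w.comp_unit]
      exact Submodule.smul_mem _ _ hf
    · obtain rfl : n = 3 := by omega
      obtain rfl : N = 4 := by omega
      exact comp_generator_mem k w hf hg
  comp_right := by
    intro n m N w f g hf hg
    have hc := w.card_eq
    rcases lt_or_ge m 3 with hm | hm
    · rw [truncatedIdeal_of_lt k hm, Submodule.mem_bot] at hg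
      simp [hg, ShuffleInsertion.comp_eq]
    rcases lt_or_ge 4 N with hN | hN
    · rw [truncatedIdeal_of_gt k hN]
      exact w.comp_mem_freeShuffle hf (truncatedIdeal_le_free k m hg)
    have hn := w.i.pos
    obtain rfl | rfl : n = 1 ∨ n = 2 := by omega
    · obtain rfl : m = N := by omega
      obtain ⟨c, rfl⟩ := eq_smul_of_mem_freeShuffle_one hf
      rw [w.unit_comp]
      exact Submodule.smul_mem _ _ hg
    · obtain rfl : m = 3 := by omega
      obtain rfl : N = 4 := by omega
      exact generator_comp_mem k w hf hg

/-- Minimality of the generated ideal. Since the larger ideal is everything from arity 5 on, nothing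
is claimed there. -/
lemma generatedIdeal_le (n : ℕ) : generatedIdeal (baseRelations k) n ≤ truncatedIdeal k n :=
  fun _ hf => mem_generatedIdeal.1 hf _ (isShuffleIdeal_truncatedIdeal k) Submodule.subset_span

end Truncation

/-! ### Leading monomials -/

section Leading

variable (k : Type*) [Field k]

lemma mem_rules {r : Rule k} : r ∈ rules k ↔
    (∃ s ∈ intRules₃, s.toRule k = r) ∨ ∃ s ∈ intRules₄, s.toRule k = r := by
  simp only [rules, Set.mem_ofPred_eq, rulesThree_eq, rulesFour_eq, List.mem_map]

lemma exists_divides_of_isReducible {n : ℕ} {T : OpTree (Fin n)} (h : isReducible T = true) :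
    ∃ r ∈ rules k, Divides r.lhs T := by
  simp only [isReducible, Bool.or_eq_true, List.any_eq_true] at h
  rcases h with ⟨r, hr, h⟩ | ⟨r, hr, h⟩
  · exact ⟨r.toRule k, (mem_rules k).2 (.inl ⟨r, hr, rfl⟩), .of_dividesB h⟩
  · exact ⟨r.toRule k, (mem_rules k).2 (.inr ⟨r, hr, rfl⟩), .of_dividesB h⟩

lemma covers : (∀ r ∈ intRules₃, ∀ i, i ∈ r.lhs.leaves) ∧
    ∀ r ∈ intRules₄, ∀ i, i ∈ r.lhs.leaves := by decide +kernel

lemma isReducible_of_divides {n : ℕ} {T : OpTree (Fin n)} {r : Rule k} (hr : r ∈ rules k)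
    (h : Divides r.lhs T) : isReducible T = true := by
  simp only [isReducible, Bool.or_eq_true, List.any_eq_true]
  rcases (mem_rules k).1 hr with ⟨s, hs, rfl⟩ | ⟨s, hs, rfl⟩
  · exact .inl ⟨s, hs, Divides.dividesB (covers.1 s hs) h⟩
  · exact .inr ⟨s, hs, Divides.dividesB (covers.2 s hs) h⟩

/-- A tree with maximal key exists by finiteness; distinct keys make it strictly larger than the
rest of the support. -/
lemma exists_isLeadingMonomial {n : ℕ} (hkeys : KeysAreDistinct n) {f : Poly k n}
    (hf : f ∈ freeShuffle k n) (h : f ≠ 0) : ∃ T, IsLeadingMonomial f T := by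
  obtain ⟨T, hT, hmax⟩ := f.support.exists_max_image orderKey (Finsupp.support_nonempty_iff.2 h)
  refine ⟨T, hT, fun S hS hne => (hmax S hS).lt_of_ne fun e => hne ?_⟩
  exact List.inj_on_of_nodup_map hkeys (mem_shuffleTrees (hf hS)) (mem_shuffleTrees (hf hT)) e

/-- The normal form of `f` is zero, but an irreducible leading monomial would keep its non-zero
coefficient in it. -/
lemma isReducible_of_isLeadingMonomial {n : ℕ} (hcomp : RewritingIsCompatible n) {f : Poly k n}
    (hf : f ∈ normalFormKer k n) {T : OpTree (Fin n)} (hT : IsLeadingMonomial f T) :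
    isReducible T = true := by
  by_contra hred
  obtain ⟨hfree, hker⟩ := hf
  have hnf := (hcomp T (mem_shuffleTrees (hfree hT.1))).1.resolve_left hred
  -- Any other tree `S` of the support has a smaller key and is sent to trees with keys at most that
  -- of `S`, so it contributes nothing at `T`.
  have e : evLinear k (normalForm 5) f T = f T := by
    rw [evLinear, Finsupp.linearCombination_apply, Finsupp.sum, Finsupp.finsetSum_apply,
      Finset.sum_eq_single T]
    · simp [hnf]
    · intro S hS hne
      rw [Finsupp.smul_apply, smul_eq_mul]
      refine mul_eq_zero_of_right _ (by_contra fun h0 => ?_)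
      obtain ⟨p, hp, rfl⟩ := exists_mem_of_ev_ne_zero k h0
      exact ((hcomp S (mem_shuffleTrees (hfree hS))).2 p hp).not_gt (hT.2 S hS hne)
    · exact fun h => absurd hT.1 h
  rw [LinearMap.mem_ker.1 hker] at e
  exact Finsupp.mem_support_iff.1 hT.1 e.symm

lemma generatedIdeal_divides_leading {n : ℕ} (hn : n ≤ 4) {f : Poly k n}
    (hf : f ∈ generatedIdeal (baseRelations k) n) (h : f ≠ 0) :
    ∃ T, IsLeadingMonomial f T ∧ ∃ r ∈ rules k, Divides r.lhs T := by
  have hf := generatedIdeal_le k n hf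
  obtain hn' | rfl | rfl : n < 3 ∨ n = 3 ∨ n = 4 := by omega
  · rw [truncatedIdeal_of_lt k hn'] at hf
    exact absurd ((Submodule.mem_bot k).1 hf) h
  · have hf := span_baseRelations_le k hf
    obtain ⟨T, hT⟩ := exists_isLeadingMonomial k keysAreDistinct_three hf.1 h
    exact ⟨T, hT, exists_divides_of_isReducible k
      (isReducible_of_isLeadingMonomial k rewritingIsCompatible_three hf hT)⟩
  · obtain ⟨T, hT⟩ := exists_isLeadingMonomial k keysAreDistinct_four hf.1 h
    exact ⟨T, hT, exists_divides_of_isReducible k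
      (isReducible_of_isLeadingMonomial k rewritingIsCompatible_four hf hT)⟩

lemma IntRule.isLeadingMonomial {n : ℕ} {r : IntRule n}
    (h : ∀ p ∈ r.rhs, orderKey p.2 < orderKey r.lhs) :
    IsLeadingMonomial (ev k r.relation) r.lhs := by
  have hrhs : ev k r.rhs r.lhs = 0 := by
    by_contra h0
    obtain ⟨p, hp, e⟩ := exists_mem_of_ev_ne_zero k h0
    exact (h p hp).ne (congrArg orderKey e)
  simp only [IsLeadingMonomial, relation, ev_cons, ev_scale]
  constructor
  · simp [hrhs]
  · intro S hS hne
    have : ev k r.rhs S ≠ 0 := by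
      simpa [Finsupp.single_apply, hne.symm] using hS
    obtain ⟨p, hp, rfl⟩ := exists_mem_of_ev_ne_zero k this
    exact h p hp

lemma rhs_lt_lhs : (∀ r ∈ intRules₃, ∀ p ∈ r.rhs, orderKey p.2 < orderKey r.lhs) ∧
    ∀ r ∈ intRules₄, ∀ p ∈ r.rhs, orderKey p.2 < orderKey r.lhs := by decide +kernel

lemma not_isReducible_rhs : (∀ r ∈ intRules₃, ∀ p ∈ r.rhs, isReducible p.2 = false) ∧
    ∀ r ∈ intRules₄, ∀ p ∈ r.rhs, isReducible p.2 = false := by decide +kernel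

lemma eq_of_dividesB_lhs :
    ((∀ r ∈ intRules₃, ∀ s ∈ intRules₃, dividesB s.lhs r.lhs = true → s = r) ∧
      ∀ r ∈ intRules₄, ∀ s ∈ intRules₄, dividesB s.lhs r.lhs = true → s = r) ∧
    ((∀ r ∈ intRules₃, ∀ s ∈ intRules₄, dividesB s.lhs r.lhs = false) ∧
      ∀ r ∈ intRules₄, ∀ s ∈ intRules₃, dividesB s.lhs r.lhs = false) := by decide +kernel

theorem isReducedGroebnerBasisUpTo_generatedIdeal [CharZero k] :
    IsReducedGroebnerBasisUpTo (generatedIdeal (baseRelations k)) 4 (rules k) where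
  arity_le := by
    intro r hr
    rcases (mem_rules k).1 hr with ⟨s, -, rfl⟩ | ⟨s, -, rfl⟩ <;> simp [IntRule.toRule]
  relation_mem := by
    intro r hr
    rw [mem_generatedIdeal]
    intro I hI hR
    rcases (mem_rules k).1 hr with ⟨s, hs, rfl⟩ | ⟨s, hs, rfl⟩ <;> rw [IntRule.relation_toRule]
    · exact hR ⟨s, hs, rfl⟩
    · exact hI.relation_mem hR hs
  leading := by
    intro r hr
    rcases (mem_rules k).1 hr with ⟨s, hs, rfl⟩ | ⟨s, hs, rfl⟩
    · rw [IntRule.relation_toRule]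
      exact s.isLeadingMonomial k (rhs_lt_lhs.1 s hs)
    · rw [IntRule.relation_toRule]
      exact s.isLeadingMonomial k (rhs_lt_lhs.2 s hs)
  divides_leading := fun n hn f hf h => generatedIdeal_divides_leading k hn hf h
  rhs_reduced := by
    intro r hr T hT s hs hd
    have hred := isReducible_of_divides k hs hd
    rcases (mem_rules k).1 hr with ⟨r', hr', rfl⟩ | ⟨r', hr', rfl⟩ <;>
      obtain ⟨p, hp, rfl⟩ := exists_mem_of_ev_ne_zero k (Finsupp.mem_support_iff.1 hT)
    · exact Bool.false_ne_true ((not_isReducible_rhs.1 r' hr' p hp).symm.trans hred)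
    · exact Bool.false_ne_true ((not_isReducible_rhs.2 r' hr' p hp).symm.trans hred)
  lhs_reduced := by
    intro r hr s hs hd
    obtain ⟨⟨h₃, h₄⟩, h₃₄, h₄₃⟩ := eq_of_dividesB_lhs
    rcases (mem_rules k).1 hr with ⟨r', hr', rfl⟩ | ⟨r', hr', rfl⟩ <;>
      rcases (mem_rules k).1 hs with ⟨s', hs', rfl⟩ | ⟨s', hs', rfl⟩
    · rw [h₃ r' hr' s' hs' (Divides.dividesB (covers.1 s' hs') hd)]
    · exact absurd ((h₃₄ r' hr' s' hs').symm.trans (Divides.dividesB (covers.2 s' hs') hd))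
        Bool.false_ne_true
    · exact absurd ((h₄₃ r' hr' s' hs').symm.trans (Divides.dividesB (covers.1 s' hs') hd))
        Bool.false_ne_true
    · rw [h₄ r' hr' s' hs' (Divides.dividesB (covers.2 s' hs') hd)]

end Leading

end ShuffleGD

theorem mainTheorem4 (k : Type*) [Field k] [CharZero k] :
    ShuffleGD.IsReducedGroebnerBasisUpTo (ShuffleGD.comGDIdeal k) 4 (ShuffleGD.rules k) ∧
    ShuffleGD.IsReducedGroebnerBasisUpTo (ShuffleGD.transposedPoissonIdeal k) 4
      (ShuffleGD.rules k) ∧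
    ∀ n, ShuffleGD.comGDIdeal k n = ShuffleGD.transposedPoissonIdeal k n := by
  rw [ShuffleGD.comGDIdeal_eq, ShuffleGD.transposedPoissonIdeal_eq]
  exact ⟨ShuffleGD.isReducedGroebnerBasisUpTo_generatedIdeal k,
    ShuffleGD.isReducedGroebnerBasisUpTo_generatedIdeal k, fun _ => rfl⟩
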